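/- Theorem. Satisfiability of sentences in the Separated Fragment (SF) is decidable. Here first-order sentences with equality are built over a signature with countably many constant symbols, no function symbols of positive arity, and, for every arity $l \ge 0$, countably many predicate symbols of arity $l$. Such a sentence belongs to SF if and only if it has the form $$\exists \vec z\, \forall \vec x_1 \exists \vec y_1 \cdots \forall \vec x_n \exists \vec y_n.\ \varphi$$ with $\varphi$ quantifier-free and the quantifiers binding pairwise distinct variables (any of the blocks may be empty), where the sets $\vec x_1 \cup \dots \cup \vec x_n$ and $\vec y_1 \cup \dots \cup \vec y_n$ are separated in $\varphi$: no atom (including equations) of $\varphi$ contains both a variable from some $\vec x_i$ and a variable from some $\vec y_j$; the variables $\vec z$ may occur together with any others. A sentence is satisfiable if it holds in some structure with nonempty universe, equality being interpreted as identity. The assertion is that there is an algorithm deciding, for a given Gödel number, whether it is the Gödel number of a satisfiable sentence in SF; that is, the set of Gödel numbers of satisfiable SF sentences is recursive. -/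

import Mathlib

namespace SeparatedFragment

open FirstOrder.Language

/-- Function symbols: countably many constant symbols and nothing of positive arity. -/
inductive FunctionSymbol : ℕ → Type
  | const (c : ℕ) : FunctionSymbol 0

/-- The signature: constant symbols `c₀, c₁, …` and, for every arity `l ≥ 0`, predicate symbols
`P₀, P₁, …` of arity `l`. Equality is a logical symbol of Mathlib's first-order formulas. -/
def signature : FirstOrder.Language.{0, 0} where
  Functions := FunctionSymbol
  Relations := fun _ => ℕ

/-- Formulas all of whose free variables are among the `n` variables `0, …, n - 1`. In such a
formula the variable bound by an outermost quantifier is number `n`. -/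
abbrev Fml (n : ℕ) := signature.BoundedFormula Empty n

/-- The set of variables occurring in a term. -/
def termVars {n : ℕ} (t : signature.Term (Empty ⊕ Fin n)) : Set (Fin n) :=
  {i | Sum.inr i ∈ t.varFinset}

/-- The sets `X` and `Y` of variables are separated in a formula: no atom of the formula contains
both a variable from `X` and a variable from `Y`. -/
def Separated : ∀ {n : ℕ}, Set (Fin n) → Set (Fin n) → Fml n → Prop
  | _, _, _, .falsum => True
  | _, X, Y, .equal s t =>
      (termVars s ∪ termVars t) ∩ X = ∅ ∨ (termVars s ∪ termVars t) ∩ Y = ∅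
  | _, X, Y, .rel _ ts =>
      (⋃ j, termVars (ts j)) ∩ X = ∅ ∨ (⋃ j, termVars (ts j)) ∩ Y = ∅
  | _, X, Y, .imp φ ψ => Separated X Y φ ∧ Separated X Y ψ
  | _, X, Y, .all φ => Separated (Fin.castSucc '' X) (Fin.castSucc '' Y) φ

/-- The two kinds of quantifiers. -/
inductive Quantifier
  | all
  | ex

/-- The sentence `Q₀ v₀ Q₁ v₁ … Qₘ₋₁ vₘ₋₁. ψ`. -/
def prenex : ∀ {m : ℕ}, (Fin m → Quantifier) → Fml m → signature.Sentence
  | 0, _, ψ => ψ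
  | m + 1, Q, ψ =>
      prenex (fun i : Fin m => Q i.castSucc)
        (match Q (Fin.last m) with
          | .all => BoundedFormula.all ψ
          | .ex => BoundedFormula.ex ψ)

/-- The Separated Fragment: sentences `∃ z⃗ ∀ x⃗₁ ∃ y⃗₁ … ∀ x⃗ₙ ∃ y⃗ₙ. ψ` with `ψ` quantifier-free in
which the variables in `x⃗₁, …, x⃗ₙ` are separated from those in `y⃗₁, …, y⃗ₙ`. Here `z⃗` consists of the
first `k` variables of the prefix; as blocks may be empty, the rest of the prefix is arbitrary. -/
def IsSF (φ : signature.Sentence) : Prop :=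
  ∃ (m : ℕ) (Q : Fin m → Quantifier) (ψ : Fml m) (k : ℕ),
    ψ.IsQF ∧ φ = prenex Q ψ ∧
    (∀ i : Fin m, (i : ℕ) < k → Q i = .ex) ∧
    Separated {i | Q i = .all} {i | k ≤ (i : ℕ) ∧ Q i = .ex} ψ

/-- Gödel numbers of terms. -/
def termCode {n : ℕ} : signature.Term (Empty ⊕ Fin n) → ℕ
  | .var (Sum.inr i) => 2 * (i : ℕ)
  | .func (FunctionSymbol.const c) _ => 2 * c + 1

/-- Gödel numbers of formulas. -/
def code : ∀ {n : ℕ}, Fml n → ℕ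
  | _, .falsum => 0
  | _, .equal s t => 4 * Nat.pair (termCode s) (termCode t) + 1
  | _, .rel (l := l) (R : ℕ) ts =>
      4 * Nat.pair R (Encodable.encode (List.ofFn fun j : Fin l => termCode (ts j))) + 2
  | _, .imp φ ψ => 4 * Nat.pair (code φ) (code ψ) + 3
  | _, .all φ => 4 * code φ + 4

theorem termCode_injective {n : ℕ} :
    Function.Injective (termCode : signature.Term (Empty ⊕ Fin n) → ℕ) := by
  intro s t h
  rcases s with (e | i) | ⟨⟨c⟩, a⟩
  · exact e.elim
  · rcases t with (e | j) | ⟨⟨d⟩, b⟩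
    · exact e.elim
    · simp only [termCode] at h
      have : i = j := Fin.ext (by omega)
      rw [this]
    · simp only [termCode] at h
      omega
  · rcases t with (e | j) | ⟨⟨d⟩, b⟩
    · exact e.elim
    · simp only [termCode] at h
      omega
    · simp only [termCode] at h
      have : c = d := by omega
      subst this
      congr 1
      exact Subsingleton.elim _ _

/-- Distinct formulas have distinct Gödel numbers. -/
theorem code_injective {n : ℕ} : Function.Injective (code : Fml n → ℕ) := by
  intro φ
  induction φ with
  | falsum =>
    intro ψ h
    cases ψ <;> simp only [code] at h <;> first | rfl | omega
  | equal s t =>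
    intro ψ h
    cases ψ <;> simp only [code] at h <;> try omega
    have h' := Nat.pair_eq_pair.1
      (Nat.eq_of_mul_eq_mul_left (Nat.succ_pos 3) (Nat.add_right_cancel h))
    rw [termCode_injective h'.1, termCode_injective h'.2]
  | @rel n l R ts =>
    intro ψ h
    cases ψ <;> simp only [code] at h <;> try omega
    rename_i l' R' ts'
    have h' := Nat.pair_eq_pair.1
      (Nat.eq_of_mul_eq_mul_left (Nat.succ_pos 3) (Nat.add_right_cancel h))
    have h2 := Encodable.encode_injective h'.2
    have hl : l = l' := by simpa using congrArg List.length h2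
    subst hl
    have h3 : ts = ts' := funext fun j =>
      termCode_injective (congrFun (List.ofFn_injective h2) j)
    have h4 : R = R' := h'.1
    rw [h3, h4]
  | imp φ₁ φ₂ ih₁ ih₂ =>
    intro ψ h
    cases ψ <;> simp only [code] at h <;> try omega
    have h' := Nat.pair_eq_pair.1
      (Nat.eq_of_mul_eq_mul_left (Nat.succ_pos 3) (Nat.add_right_cancel h))
    rw [ih₁ h'.1, ih₂ h'.2]
  | all φ ih =>
    intro ψ h
    cases ψ <;> simp only [code] at h <;> try omega
    rw [ih (Nat.eq_of_mul_eq_mul_left (Nat.succ_pos 3) (Nat.add_right_cancel h))]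

end SeparatedFragment

/-!
Satisfiability in the Separated Fragment is decidable because the fragment has the finite model
property with a computable bound on the size of the model.

*Small models.* Let `M` be a model of `∃ z⃗ ∀ x⃗₁ ∃ y⃗₁ … ψ`, and fix witnesses for `z⃗`. By
separation, the truth of `ψ` depends on the values of the `x⃗ᵢ` and, apart from these, only on the
truth values of the finitely many atoms without such variables (`realize_iff_of_separated`); these
truth values are recorded by the `profile` of an assignment. Call the profile the type of a complete
assignment, and let the type of a partial one be the set of the types that its next existential
variable can bring about, universal variables being skipped (`posType`). The types before `r`
remaining quantifiers are elements of an `r`-fold iterated power set of a finite set, so there are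
boundedly many of them, and a finite set `S ⊆ M` of bounded size contains, at each stage, a witness
for each type that can be brought about (`exists_hasWitnesses`). The existential player can then
copy a winning strategy on `M` into `S`, keeping the type rather than the values
(`quantify_of_hasWitnesses`), while the universal player only loses moves. Hence `S`, together with
the values of `z⃗` and of the constants, carries a model (`exists_prenexTrue`).

*The search.* A number is the Gödel number of a satisfiable sentence of the fragment if and only if
there are a prefix, a matrix and a finite structure, all from finite sets computable from the
number, in which the sentence evaluates to true (`exists_satisfiable_iff`). The syntactic checks
and the evaluation of the matrix are folds over Gödel numbers, the quantifiers are evaluated by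
computing lists of satisfying assignments, and the finite structures are listed explicitly, so that
the whole search is primitive recursive (`primrecPred_search`).
-/

namespace SeparatedFragment

open FirstOrder.Language

/-! ### Quantifier prefixes as games -/

/-- The truth of a quantifier prefix over a set `S` of admissible values: in `quantify S qs i P u`
the entries of `qs` (`true` for `∃`, `false` for `∀`) quantify, from the left to the right, the
values at `i, i + 1, …` of the assignment `u`, after which `P` has to hold. -/
def quantify {A : Type} (S : Set A) :
    List Bool → ℕ → ((ℕ → A) → Prop) → (ℕ → A) → Prop
  | [], _, P, u => P u
  | true :: qs, i, P, u => ∃ a ∈ S, quantify S qs (i + 1) P (Function.update u i a)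
  | false :: qs, i, P, u => ∀ a ∈ S, quantify S qs (i + 1) P (Function.update u i a)

/-- The innermost quantifier can be absorbed into the matrix; `prenex` builds prefixes this way. -/
theorem quantify_append {A : Type} (S : Set A) (q : Bool) (P : (ℕ → A) → Prop) (qs : List Bool)
    (i : ℕ) (u : ℕ → A) :
    quantify S (qs ++ [q]) i P u ↔
      quantify S qs i (fun v => quantify S [q] (i + qs.length) P v) u := by
  induction qs generalizing i u with
  | nil => simp [quantify]
  | cons b qs ih =>
    cases b <;> simp only [quantify, List.cons_append, List.length_cons] <;>
      simp only [ih, Nat.add_assoc, Nat.add_comm 1]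

/-- A prefix over the image of a set may be evaluated over the set itself. -/
theorem quantify_image {A B : Type} (g : A → B) (S : Set A) (P : (ℕ → B) → Prop) (qs : List Bool)
    (i : ℕ) (u : ℕ → A) :
    quantify (g '' S) qs i P (g ∘ u) ↔ quantify S qs i (fun v => P (g ∘ v)) u := by
  induction qs generalizing i u with
  | nil => simp [quantify]
  | cons b qs ih =>
    cases b <;> simp only [quantify, Set.exists_mem_image, Set.forall_mem_image] <;>
      simp only [← ih, Function.comp_update]

theorem quantify_congr {A : Type} {S : Set A} {P P' : (ℕ → A) → Prop} (h : ∀ u, P u ↔ P' u)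
    (qs : List Bool) (i : ℕ) (u : ℕ → A) :
    quantify S qs i P u ↔ quantify S qs i P' u := by
  rw [funext fun v => propext (h v)]

/-- If the matrix depends only on the values up to the last quantified one, then the truth of the
prefix depends only on the values before the first quantified one. -/
theorem quantify_congr_start {A : Type} {S : Set A} {P : (ℕ → A) → Prop} {qs : List Bool} {i : ℕ}
    {u u' : ℕ → A} (hP : ∀ v v' : ℕ → A, (∀ j < i + qs.length, v j = v' j) → (P v ↔ P v'))
    (h : ∀ j < i, u j = u' j) : quantify S qs i P u ↔ quantify S qs i P u' := by
  induction qs generalizing i u u' with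
  | nil => exact hP u u' h
  | cons b qs ih =>
    have hP' : ∀ v v' : ℕ → A, (∀ j < i + 1 + qs.length, v j = v' j) → (P v ↔ P v') :=
      fun v v' hv => hP v v' fun j hj => hv j (by rw [List.length_cons] at hj; omega)
    have key : ∀ a, quantify S qs (i + 1) P (Function.update u i a) ↔
        quantify S qs (i + 1) P (Function.update u' i a) := fun a => by
      refine ih hP' fun j hj => ?_
      by_cases hji : j = i
      · simp [hji]
      · simp [hji, h j (by omega)]
    cases b <;> simp only [quantify, key]

/-! ### The finite model property -/

/-- The `r`-fold iterated power set of `Y`, in which the types of positions with `r` quantifiers to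
come live. -/
def IterSet (Y : Type) : ℕ → Type
  | 0 => Y
  | r + 1 => Set (IterSet Y r)

instance IterSet.finite (Y : Type) [Finite Y] : ∀ r, Finite (IterSet Y r)
  | 0 => inferInstanceAs (Finite Y)
  | r + 1 => have := IterSet.finite Y r; inferInstanceAs (Finite (Set (IterSet Y r)))

/-- The pair of a bound for the number of types and of a bound for the number of witnesses, when
there are `t` types at the end of a prefix of length `r`. -/
def sizes (t : ℕ) : ℕ → ℕ × ℕ
  | 0 => (t, 0)
  | r + 1 => (2 ^ (sizes t r).1, (sizes t r).1 * ((sizes t r).2 + 1))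

theorem card_iterSet (Y : Type) [Finite Y] (r : ℕ) :
    Nat.card (IterSet Y r) = (sizes (Nat.card Y) r).1 := by
  induction r with
  | zero => rfl
  | succ r ih =>
    have := Fintype.ofFinite (IterSet Y r)
    have h : Nat.card (Set (IterSet Y r)) = 2 ^ Nat.card (IterSet Y r) := by
      rw [Nat.card_eq_fintype_card, Nat.card_eq_fintype_card, Fintype.card_set]
    exact h.trans (by rw [ih]; rfl)

theorem sizes_fst_pos {t : ℕ} (ht : 0 < t) : ∀ r, 0 < (sizes t r).1
  | 0 => ht
  | _ + 1 => Nat.two_pow_pos _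

theorem sizes_snd_lt_succ {t : ℕ} (ht : 0 < t) (r : ℕ) :
    (sizes t r).2 + 1 ≤ (sizes t (r + 1)).2 :=
  Nat.le_mul_of_pos_left _ (sizes_fst_pos ht r)

theorem sizes_snd_mono {t : ℕ} (ht : 0 < t) : Monotone fun r => (sizes t r).2 :=
  monotone_nat_of_le_succ fun r => (Nat.le_succ _).trans (sizes_snd_lt_succ ht r)

section Types

variable {A Y : Type} (β : (ℕ → A) → Y)

/-- The type of an assignment before a prefix: `β` of it once the prefix is used up, and before an
existential quantifier the set of all types that can be reached through it. Universal quantifiers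
are skipped, since `β` does not depend on their variables. -/
def posType : (qs : List Bool) → ℕ → (ℕ → A) → IterSet Y qs.length
  | [], _, u => β u
  | true :: qs, i, u => Set.range fun a => posType qs (i + 1) (Function.update u i a)
  | false :: qs, i, u => ({posType qs (i + 1) u} : Set (IterSet Y qs.length))

/-- `S` contains enough witnesses: whichever type can be reached through an existential quantifier
can be reached by a witness from `S`, and so on along the prefix. -/
def HasWitnesses (S : Set A) : List Bool → ℕ → (ℕ → A) → Prop
  | [], _, _ => True
  | true :: qs, i, u => ∀ a, ∃ b ∈ S,
      posType β qs (i + 1) (Function.update u i b) = posType β qs (i + 1) (Function.update u i a) ∧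
        HasWitnesses S qs (i + 1) (Function.update u i b)
  | false :: qs, i, u => HasWitnesses S qs (i + 1) u

variable {β} {X : Set ℕ}

theorem update_agree {X : Set ℕ} {u u' : ℕ → A} (h : ∀ j ∉ X, u j = u' j) (i : ℕ) (a : A) :
    ∀ j ∉ X, Function.update u i a j = Function.update u' i a j := by
  intro j hj
  by_cases hji : j = i
  · subst hji; simp
  · simp [hji, h j hj]

theorem update_agree_of_mem {X : Set ℕ} {u u' : ℕ → A} (h : ∀ j ∉ X, u j = u' j) {i : ℕ}
    (hi : i ∈ X) (a b : A) :
    ∀ j ∉ X, Function.update u i a j = Function.update u' i b j := by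
  intro j hj
  have hji : j ≠ i := fun e => hj (e ▸ hi)
  simp [hji, h j hj]

theorem posType_congr (hβ : ∀ u u', (∀ j ∉ X, u j = u' j) → β u = β u') (qs : List Bool) (i : ℕ)
    (u u' : ℕ → A) (h : ∀ j ∉ X, u j = u' j) : posType β qs i u = posType β qs i u' := by
  induction qs generalizing i u u' with
  | nil => exact hβ u u' h
  | cons b qs ih =>
    cases b
    · exact congrArg (fun τ => ({τ} : Set (IterSet Y qs.length))) (ih (i + 1) u u' h)
    · simp only [posType]
      congr 1
      funext a
      exact ih _ _ _ (update_agree h i a)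

theorem HasWitnesses.congr (hβ : ∀ u u', (∀ j ∉ X, u j = u' j) → β u = β u') {S : Set A}
    {qs : List Bool} {i : ℕ} {u u' : ℕ → A} (h : ∀ j ∉ X, u j = u' j)
    (hu : HasWitnesses β S qs i u) : HasWitnesses β S qs i u' := by
  induction qs generalizing i u u' with
  | nil => trivial
  | cons b qs ih =>
    cases b
    · exact ih h hu
    · intro a
      obtain ⟨b, hb, hab, hw⟩ := hu a
      refine ⟨b, hb, ?_, ih (update_agree h i b) hw⟩
      rw [← posType_congr hβ qs (i + 1) _ _ (update_agree h i b),
        ← posType_congr hβ qs (i + 1) _ _ (update_agree h i a), hab]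

theorem HasWitnesses.mono {S S' : Set A} (hS : S ⊆ S') {qs : List Bool} {i : ℕ} {u : ℕ → A}
    (hu : HasWitnesses β S qs i u) : HasWitnesses β S' qs i u := by
  induction qs generalizing i u with
  | nil => trivial
  | cons b qs ih =>
    cases b
    · exact ih hu
    · intro a
      obtain ⟨b, hb, hab, hw⟩ := hu a
      exact ⟨b, hS hb, hab, ih hw⟩

theorem exists_hasWitnesses [Finite Y] (qs : List Bool) (i : ℕ) (u : ℕ → A) :
    ∃ S : Finset A, S.card ≤ (sizes (Nat.card Y) qs.length).2 ∧ HasWitnesses β S qs i u := by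
  classical
  induction qs generalizing i u with
  | nil => exact ⟨∅, by simp, trivial⟩
  | cons b qs ih =>
    have hY : 0 < Nat.card Y := Nat.card_pos_iff.2 ⟨⟨β u⟩, inferInstance⟩
    cases b
    · obtain ⟨S, hS, hw⟩ := ih (i + 1) u
      exact ⟨S, hS.trans (sizes_snd_mono hY (Nat.le_succ _)), hw⟩
    · have := Fintype.ofFinite (IterSet Y qs.length)
      -- `f` picks a witness for each type that can be reached; its other values are irrelevant.
      have hf : ∀ τ : IterSet Y qs.length, ∃ b,
          (∃ a, posType β qs (i + 1) (Function.update u i a) = τ) →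
          posType β qs (i + 1) (Function.update u i b) = τ := by
        intro τ
        by_cases h : ∃ a, posType β qs (i + 1) (Function.update u i a) = τ
        · exact ⟨h.choose, fun _ => h.choose_spec⟩
        · exact ⟨u 0, fun h' => absurd h' h⟩
      choose f hf using hf
      choose S hS hw using fun τ => ih (i + 1) (Function.update u i (f τ))
      refine ⟨Finset.univ.biUnion fun τ => insert (f τ) (S τ), ?_, fun a => ?_⟩
      · refine (Finset.card_biUnion_le_card_mul _ _ ((sizes (Nat.card Y) qs.length).2 + 1)
          fun τ _ => (Finset.card_insert_le _ _).trans (Nat.succ_le_succ (hS τ))).trans ?_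
        rw [Finset.card_univ, ← Nat.card_eq_fintype_card, card_iterSet]
        rfl
      · set τ := posType β qs (i + 1) (Function.update u i a) with hτ
        have hsub : insert (f τ) (S τ) ⊆ Finset.univ.biUnion fun τ => insert (f τ) (S τ) :=
          Finset.subset_biUnion_of_mem (fun τ => insert (f τ) (S τ)) (Finset.mem_univ τ)
        refine ⟨f τ, hsub (Finset.mem_insert_self _ _), hf τ ⟨a, rfl⟩, (hw τ).mono ?_⟩
        exact fun x hx => hsub (Finset.mem_insert_of_mem hx)

/-- A prefix that holds with all values admitted holds with the values from a set with enough
witnesses. The universal player is restricted to fewer moves; the existential player answers a move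
by one of `S` leading to the same type, so that the values in `Y` deviate from those of the original
play while `β` takes the same value at the end. -/
theorem quantify_of_hasWitnesses {Z : Set ℕ} {P : (ℕ → A) → Prop}
    (hβ : ∀ u u', (∀ j ∉ X, u j = u' j) → β u = β u')
    (hP : ∀ u u', (∀ j ∉ Z, u j = u' j) → β u = β u' → P u → P u') {S : Set A} {qs : List Bool}
    {i : ℕ} {u u' : ℕ → A} (hX : ∀ j, qs[j]? = some false → i + j ∈ X)
    (hZ : ∀ j, qs[j]? = some true → i + j ∈ Z) (hu : ∀ j ∉ Z, u j = u' j)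
    (ht : posType β qs i u = posType β qs i u') (hS : HasWitnesses β S qs i u')
    (h : quantify Set.univ qs i P u) : quantify S qs i P u' := by
  induction qs generalizing i u u' with
  | nil => exact hP u u' hu ht h
  | cons b qs ih =>
    have hX' : ∀ j, qs[j]? = some false → i + 1 + j ∈ X := fun j hj => by
      simpa [Nat.add_assoc, Nat.add_comm 1] using hX (j + 1) (by simpa using hj)
    have hZ' : ∀ j, qs[j]? = some true → i + 1 + j ∈ Z := fun j hj => by
      simpa [Nat.add_assoc, Nat.add_comm 1] using hZ (j + 1) (by simpa using hj)
    cases b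
    · have hi : i ∈ X := hX 0 (by simp)
      intro a _
      have e : ∀ v : ℕ → A, ∀ j ∉ X, v j = Function.update v i a j := fun v j hj => by
        have hji : j ≠ i := fun e => hj (e ▸ hi)
        simp [hji]
      refine ih hX' hZ' (update_agree hu i a) ?_ (hS.congr hβ (e u')) (h a trivial)
      rw [← posType_congr hβ qs _ _ _ (e u), ← posType_congr hβ qs _ _ _ (e u')]
      exact Set.singleton_injective ht
    · have hi : i ∈ Z := hZ 0 (by simp)
      obtain ⟨a, -, ha⟩ := h
      have hmem : posType β qs (i + 1) (Function.update u i a) ∈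
          Set.range fun a => posType β qs (i + 1) (Function.update u' i a) := by
        have ht' : (Set.range fun a => posType β qs (i + 1) (Function.update u i a)) =
          Set.range fun a => posType β qs (i + 1) (Function.update u' i a) := ht
        rw [← ht']
        exact ⟨a, rfl⟩
      obtain ⟨a', ha'⟩ := hmem
      obtain ⟨b, hb, hab, hw⟩ := hS a'
      exact ⟨b, hb, ih hX' hZ' (update_agree_of_mem hu hi a b) (ha'.symm.trans hab.symm) hw ha⟩

/-- A prefix that starts with existential quantifiers `zs` and holds with all values admitted holds
over all sets containing some finite set, whose size is bounded in terms of the number of types. -/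
theorem exists_finset_quantify [Finite Y] {Z : Set ℕ} {P : (ℕ → A) → Prop}
    (hβ : ∀ u u', (∀ j ∉ X, u j = u' j) → β u = β u')
    (hP : ∀ u u', (∀ j ∉ Z, u j = u' j) → β u = β u' → P u → P u') {zs qs : List Bool}
    {i : ℕ} {u : ℕ → A} (hzs : ∀ b ∈ zs, b = true)
    (hX : ∀ j, qs[j]? = some false → i + zs.length + j ∈ X)
    (hZ : ∀ j, qs[j]? = some true → i + zs.length + j ∈ Z)
    (h : quantify Set.univ (zs ++ qs) i P u) :
    ∃ S₀ : Finset A, S₀.card ≤ (sizes (Nat.card Y) (zs.length + qs.length)).2 ∧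
      ∀ S : Set A, ↑S₀ ⊆ S → quantify S (zs ++ qs) i P u := by
  classical
  induction zs generalizing i u with
  | nil =>
    obtain ⟨S₀, hc, hw⟩ := exists_hasWitnesses (β := β) qs i u
    refine ⟨S₀, by simpa using hc, fun S hS => ?_⟩
    exact quantify_of_hasWitnesses hβ hP hX hZ (fun _ _ => rfl) rfl (hw.mono hS) h
  | cons b zs ih =>
    obtain rfl : b = true := hzs b (by simp)
    have hY : 0 < Nat.card Y := Nat.card_pos_iff.2 ⟨⟨β u⟩, inferInstance⟩
    obtain ⟨a, -, ha⟩ := h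
    obtain ⟨S₀, hc, hw⟩ := ih (fun b hb => hzs b (by simp [hb]))
      (fun j hj => by simpa [Nat.add_assoc, Nat.add_comm 1] using hX j hj)
      (fun j hj => by simpa [Nat.add_assoc, Nat.add_comm 1] using hZ j hj) ha
    refine ⟨insert a S₀, ?_, fun S hS => ⟨a, hS (by simp), hw S fun x hx => hS (by simp_all)⟩⟩
    refine (Finset.card_insert_le _ _).trans ((Nat.succ_le_succ hc).trans ?_)
    rw [List.length_cons, Nat.add_right_comm]
    exact sizes_snd_lt_succ hY _

end Types

/-! ### Formulas and their Gödel numbers -/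

/-- Evaluation of the Gödel number of a quantifier-free formula as a Boolean circuit: `A` gives the
values of the atoms, `z` that of `⊥` and `op` interprets the implication. -/
def matrixFold (A : ℕ → Bool) (op : Bool → Bool → Bool) (z : Bool) : ℕ → Bool
  | 0 => z
  | n + 1 =>
    if n % 4 = 2 then
      op (matrixFold A op z (n / 4).unpair.1) (matrixFold A op z (n / 4).unpair.2)
    else if n % 4 = 3 then false
    else A (n + 1)
  decreasing_by
    · exact Nat.lt_succ_of_le ((Nat.unpair_left_le _).trans (Nat.div_le_self _ _))
    · exact Nat.lt_succ_of_le ((Nat.unpair_right_le _).trans (Nat.div_le_self _ _))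

/-- The list of the Gödel numbers of the terms in an atom. -/
def atomArgs (a : ℕ) : List ℕ :=
  if a % 4 = 1 then [(a / 4).unpair.1, (a / 4).unpair.2]
  else Denumerable.ofNat (List ℕ) (a / 4).unpair.2

section Fold

variable (A : ℕ → Bool) (op : Bool → Bool → Bool) (z : Bool)

theorem matrixFold_zero : matrixFold A op z 0 = z := by
  rw [matrixFold]

theorem matrixFold_equal (q : ℕ) : matrixFold A op z (4 * q + 1) = A (4 * q + 1) := by
  rw [matrixFold, if_neg (by omega), if_neg (by omega)]

theorem matrixFold_rel (q : ℕ) : matrixFold A op z (4 * q + 2) = A (4 * q + 2) := by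
  rw [matrixFold, if_neg (by omega), if_neg (by omega)]

theorem matrixFold_imp (p q : ℕ) : matrixFold A op z (4 * Nat.pair p q + 3) =
    op (matrixFold A op z p) (matrixFold A op z q) := by
  rw [matrixFold, if_pos (by omega)]
  have : (4 * Nat.pair p q + 2) / 4 = Nat.pair p q := by omega
  rw [this, Nat.unpair_pair]

theorem matrixFold_all (q : ℕ) : matrixFold A op z (4 * q + 4) = false := by
  rw [matrixFold, if_neg (by omega), if_pos (by omega)]

end Fold

theorem atomArgs_equal (s t : ℕ) : atomArgs (4 * Nat.pair s t + 1) = [s, t] := by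
  have : (4 * Nat.pair s t + 1) / 4 = Nat.pair s t := by omega
  rw [atomArgs, if_pos (by omega), this, Nat.unpair_pair]

theorem atomArgs_rel (R : ℕ) (l : List ℕ) :
    atomArgs (4 * Nat.pair R (Encodable.encode l) + 2) = l := by
  have : (4 * Nat.pair R (Encodable.encode l) + 2) / 4 = Nat.pair R (Encodable.encode l) := by omega
  rw [atomArgs, if_neg (by omega), this, Nat.unpair_pair]
  exact Denumerable.ofNat_encode l

/-- The condition on an atom of a matrix below the prefix `l` (with `true` for `∃`): it contains
only variables of the prefix, and not both a universal variable and an existential one that comes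
after the first `k`. -/
def AtomOK (l : List Bool) (k a : ℕ) : Prop :=
  (∀ t ∈ atomArgs a, t % 2 = 0 → t / 2 < l.length) ∧
    ((∀ t ∈ atomArgs a, t % 2 = 0 → ¬ l[t / 2]? = some false) ∨
      ∀ t ∈ atomArgs a, t % 2 = 0 → ¬ (k ≤ t / 2 ∧ l[t / 2]? = some true))

open scoped Classical in
/-- Whether a number is the Gödel number of a quantifier-free matrix as the Separated Fragment
allows below the prefix `l`. -/
noncomputable def matrixOK (l : List Bool) (k : ℕ) : ℕ → Bool :=
  matrixFold (fun a => decide (AtomOK l k a)) and true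

theorem termCode_even {m : ℕ} (t : signature.Term (Empty ⊕ Fin m)) (h : termCode t % 2 = 0) :
    ∃ i : Fin m, t = .var (Sum.inr i) := by
  rcases t with (e | i) | ⟨⟨c⟩, a⟩
  · exact e.elim
  · exact ⟨i, rfl⟩
  · simp only [termCode] at h
    omega

theorem mem_termVars {m : ℕ} (t : signature.Term (Empty ⊕ Fin m)) (i : Fin m) :
    i ∈ termVars t ↔ termCode t = 2 * (i : ℕ) := by
  rcases t with (e | j) | ⟨⟨c⟩, a⟩
  · exact e.elim
  · simp only [termVars, termCode, FirstOrder.Language.Term.varFinset, Set.mem_ofPred_eq,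
      Finset.mem_singleton, Sum.inr.injEq, Fin.ext_iff]
    omega
  · simp only [termVars, termCode, FirstOrder.Language.Term.varFinset, Set.mem_ofPred_eq]
    simp
    omega

theorem exists_termCode_eq {m t : ℕ} (h : t % 2 = 0 → t / 2 < m) :
    ∃ s : signature.Term (Empty ⊕ Fin m), termCode s = t := by
  rcases Nat.mod_two_eq_zero_or_one t with h0 | h1
  · refine ⟨.var (Sum.inr ⟨t / 2, h h0⟩), ?_⟩
    simp only [termCode]
    omega
  · refine ⟨.func (FunctionSymbol.const (t / 2)) Fin.elim0, ?_⟩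
    simp only [termCode]
    omega

theorem termCode_div_lt {m : ℕ} (t : signature.Term (Empty ⊕ Fin m)) (h : termCode t % 2 = 0) :
    termCode t / 2 < m := by
  obtain ⟨i, rfl⟩ := termCode_even t h
  simp [termCode]

/-- The universal variables of a prefix. -/
def univVars (l : List Bool) (m : ℕ) : Set (Fin m) := {i | l[(i : ℕ)]? = some false}

/-- The existential variables of a prefix that come after the first `k` variables. -/
def exVars (l : List Bool) (k m : ℕ) : Set (Fin m) := {i | k ≤ (i : ℕ) ∧ l[(i : ℕ)]? = some true}

theorem inter_eq_empty_iff_args {m : ℕ} {V : Set (Fin m)} {args : List ℕ}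
    (hV : ∀ i, i ∈ V ↔ 2 * (i : ℕ) ∈ args) (hm : ∀ t ∈ args, t % 2 = 0 → t / 2 < m) (p : ℕ → Prop) :
    V ∩ {i : Fin m | p i} = ∅ ↔ ∀ t ∈ args, t % 2 = 0 → ¬ p (t / 2) := by
  rw [Set.eq_empty_iff_forall_notMem]
  constructor
  · intro h t ht h0 hp
    refine h ⟨t / 2, hm t ht h0⟩ ⟨(hV _).2 ?_, hp⟩
    have : 2 * (t / 2) = t := by omega
    simpa only [this] using ht
  · rintro h i ⟨hi, hp⟩
    refine h _ ((hV i).1 hi) (by omega) ?_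
    have : 2 * (i : ℕ) / 2 = i := by omega
    rw [this]
    exact hp

theorem atomOK_iff {l : List Bool} {k m a : ℕ} (hl : l.length = m) {V : Set (Fin m)}
    (hV : ∀ i, i ∈ V ↔ 2 * (i : ℕ) ∈ atomArgs a)
    (hm : ∀ t ∈ atomArgs a, t % 2 = 0 → t / 2 < m) :
    AtomOK l k a ↔ V ∩ univVars l m = ∅ ∨ V ∩ exVars l k m = ∅ := by
  rw [univVars, exVars, inter_eq_empty_iff_args hV hm fun i => l[i]? = some false,
    inter_eq_empty_iff_args hV hm fun i => k ≤ i ∧ l[i]? = some true, AtomOK, hl]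
  exact and_iff_right hm

theorem atomOK_equal_iff {l : List Bool} {k m : ℕ} (hl : l.length = m)
    (s t : signature.Term (Empty ⊕ Fin m)) :
    AtomOK l k (code (.equal s t : Fml m)) ↔
      Separated (univVars l m) (exVars l k m) (.equal s t : Fml m) := by
  have e : atomArgs (code (.equal s t : Fml m)) = [termCode s, termCode t] := atomArgs_equal _ _
  refine (atomOK_iff hl (V := termVars s ∪ termVars t) ?_ ?_).trans Iff.rfl
  · intro i
    rw [e, Set.mem_union, mem_termVars, mem_termVars]
    simp [eq_comm]
  · rw [e]
    intro τ hτ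
    rcases List.mem_pair.1 hτ with rfl | rfl
    exacts [termCode_div_lt _, termCode_div_lt _]

theorem atomOK_rel_iff {l : List Bool} {k m n : ℕ} (hl : l.length = m) (R : ℕ)
    (ts : Fin n → signature.Term (Empty ⊕ Fin m)) :
    AtomOK l k (code (.rel (l := n) R ts : Fml m)) ↔
      Separated (univVars l m) (exVars l k m) (.rel (l := n) R ts : Fml m) := by
  have e : atomArgs (code (.rel (l := n) R ts : Fml m)) = List.ofFn fun j => termCode (ts j) :=
    atomArgs_rel _ _
  refine (atomOK_iff hl (V := ⋃ j, termVars (ts j)) ?_ ?_).trans Iff.rfl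
  · intro i
    rw [e]
    simp [mem_termVars, List.mem_ofFn']
  · rw [e]
    intro τ hτ
    obtain ⟨j, rfl⟩ := (List.mem_ofFn' _ _).1 hτ
    exact termCode_div_lt _

open scoped Classical in
theorem matrixOK_code {l : List Bool} {k m : ℕ} (hl : l.length = m) {ψ : Fml m} (hψ : ψ.IsQF)
    (hs : Separated (univVars l m) (exVars l k m) ψ) : matrixOK l k (code ψ) = true := by
  induction hψ with
  | falsum => exact matrixFold_zero _ _ _
  | of_isAtomic h =>
    cases h with
    | equal s t =>
      exact (matrixFold_equal _ _ _ _).trans (decide_eq_true ((atomOK_equal_iff hl s t).2 hs))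
    | rel R ts =>
      exact (matrixFold_rel _ _ _ _).trans (decide_eq_true ((atomOK_rel_iff hl R ts).2 hs))
  | imp _ _ ih₁ ih₂ =>
    refine (matrixFold_imp _ _ _ _ _).trans ?_
    rw [Bool.and_eq_true]
    exact ⟨ih₁ hs.1, ih₂ hs.2⟩

open scoped Classical in
theorem exists_code_eq_of_matrixOK {l : List Bool} {k m : ℕ} (hl : l.length = m) (p : ℕ)
    (h : matrixOK l k p = true) :
    ∃ ψ : Fml m, ψ.IsQF ∧ code ψ = p ∧ Separated (univVars l m) (exVars l k m) ψ := by
  induction p using Nat.strong_induction_on with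
  | _ p ih =>
  rcases p with _ | n
  · exact ⟨.falsum, .falsum, rfl, trivial⟩
  obtain ⟨q, r, hr, hn⟩ : ∃ q r, r < 4 ∧ n = 4 * q + r := ⟨n / 4, n % 4, by omega, by omega⟩
  subst hn
  obtain ⟨a, b, rfl⟩ : ∃ a b, q = Nat.pair a b := ⟨_, _, (Nat.pair_unpair q).symm⟩
  interval_cases r
  · have hA := of_decide_eq_true ((matrixFold_equal _ _ _ _).symm.trans h)
    have hlt := hA.1
    rw [Nat.add_zero, atomArgs_equal, hl] at hlt
    obtain ⟨s, rfl⟩ := exists_termCode_eq (hlt a (by simp))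
    obtain ⟨t, rfl⟩ := exists_termCode_eq (hlt b (by simp))
    exact ⟨.equal s t, .of_isAtomic (.equal s t), rfl, (atomOK_equal_iff hl s t).1 hA⟩
  · have hA := of_decide_eq_true ((matrixFold_rel _ _ _ _).symm.trans h)
    have hlt := hA.1
    obtain ⟨args, rfl⟩ : ∃ args : List ℕ, b = Encodable.encode args :=
      ⟨Denumerable.ofNat (List ℕ) b, (Denumerable.encode_ofNat (α := List ℕ) b).symm⟩
    change ∀ t ∈ atomArgs (4 * Nat.pair a (Encodable.encode args) + 2), _ at hlt
    rw [atomArgs_rel, hl] at hlt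
    choose ts hts using fun j : Fin args.length =>
      exists_termCode_eq (hlt (args.get j) (List.get_mem _ _))
    have hcode : code (.rel (l := args.length) a ts : Fml m) =
        4 * Nat.pair a (Encodable.encode args) + 2 := by
      simp only [code, hts, List.ofFn_get]
    refine ⟨.rel (l := args.length) a ts, .of_isAtomic (.rel (l := args.length) _ ts), hcode,
      (atomOK_rel_iff hl a ts).1 ?_⟩
    rw [hcode]
    exact hA
  · have hA := (matrixFold_imp _ _ _ _ _).symm.trans h
    rw [Bool.and_eq_true] at hA
    have h1 := Nat.left_le_pair a b
    have h2 := Nat.right_le_pair a b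
    obtain ⟨ψ₁, hq₁, rfl, hs₁⟩ := ih a (by omega) hA.1
    obtain ⟨ψ₂, hq₂, rfl, hs₂⟩ := ih b (by omega) hA.2
    exact ⟨ψ₁.imp ψ₂, hq₁.imp hq₂, rfl, hs₁, hs₂⟩
  · exact absurd ((matrixFold_all _ _ _ _).symm.trans h) (by simp)

/-- `true` for the existential quantifier. -/
def Quantifier.isEx : Quantifier → Bool
  | .all => false
  | .ex => true

/-- The Gödel number of a formula after an `∃` (for `true`) or a `∀` (for `false`) is put in front
of it. -/
def quantCode (b : Bool) (p : ℕ) : ℕ :=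
  bif b then 4 * Nat.pair (4 * (4 * Nat.pair p 0 + 3) + 4) 0 + 3 else 4 * p + 4

theorem lt_quantCode (b : Bool) (p : ℕ) : p < quantCode b p := by
  cases b
  · simp only [quantCode, cond_false]; omega
  · simp only [quantCode, cond_true]
    have h1 := Nat.left_le_pair p 0
    have h2 := Nat.left_le_pair (4 * (4 * Nat.pair p 0 + 3) + 4) 0
    omega

/-- The Gödel number of a sentence with a given prefix and a given matrix. -/
def prefixCode (l : List Bool) (p : ℕ) : ℕ := l.foldr quantCode p

theorem le_prefixCode (l : List Bool) (p : ℕ) : l.length + p ≤ prefixCode l p := by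
  induction l with
  | nil => simp [prefixCode]
  | cons b l ih =>
    have := lt_quantCode b (prefixCode l p)
    simp only [prefixCode, List.foldr_cons, List.length_cons] at *
    omega

theorem code_prenex {m : ℕ} (Q : Fin m → Quantifier) (ψ : Fml m) :
    code (prenex Q ψ) = prefixCode (List.ofFn fun i => (Q i).isEx) (code ψ) := by
  induction m with
  | zero => rfl
  | succ m ih =>
    rw [prenex, ih, List.ofFn_succ_last, prefixCode, prefixCode, List.foldr_append]
    congr 1
    cases h : Q (Fin.last m) <;> rfl

theorem getElem?_ofFn_isEx {m : ℕ} (Q : Fin m → Quantifier) (i : Fin m) :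
    (List.ofFn fun i => (Q i).isEx)[(i : ℕ)]? = some (Q i).isEx := by
  simp

/-- Membership in the Separated Fragment in terms of the list of the quantifiers. -/
theorem isSF_iff (φ : signature.Sentence) :
    IsSF φ ↔ ∃ (m : ℕ) (Q : Fin m → Quantifier) (ψ : Fml m) (l : List Bool) (k : ℕ),
      l = (List.ofFn fun i => (Q i).isEx) ∧ k ≤ m ∧ ψ.IsQF ∧ φ = prenex Q ψ ∧
        (∀ b ∈ l.take k, b = true) ∧ Separated (univVars l m) (exVars l k m) ψ := by
  have h1 : ∀ q : Quantifier, q.isEx = false ↔ q = .all := by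
    rintro (_ | _) <;> simp [Quantifier.isEx]
  have h2 : ∀ q : Quantifier, q.isEx = true ↔ q = .ex := by
    rintro (_ | _) <;> simp [Quantifier.isEx]
  have hX : ∀ {m : ℕ} (Q : Fin m → Quantifier), univVars (List.ofFn fun i => (Q i).isEx) m =
      {i | Q i = .all} := fun Q => by
    ext i; simp only [univVars, Set.mem_ofPred_eq, getElem?_ofFn_isEx, Option.some_inj, h1]
  have hY : ∀ {m : ℕ} (Q : Fin m → Quantifier) (k : ℕ), exVars (List.ofFn fun i => (Q i).isEx) k m =
      {i : Fin m | k ≤ (i : ℕ) ∧ Q i = .ex} := fun {m} Q k => by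
    ext i; simp only [exVars, Set.mem_ofPred_eq, getElem?_ofFn_isEx, Option.some_inj, h2]
  have hT : ∀ {m : ℕ} (Q : Fin m → Quantifier) (k : ℕ),
      (∀ b ∈ (List.ofFn fun i => (Q i).isEx).take k, b = true) ↔
        ∀ i : Fin m, (i : ℕ) < k → Q i = .ex := fun {m} Q k => by
    simp only [List.mem_take_iff_getElem, List.length_ofFn, List.getElem_ofFn]
    constructor
    · intro h i hi
      exact (h2 _).1 (h _ ⟨i, by simp [hi, i.2], rfl⟩)
    · rintro h _ ⟨i, hi, rfl⟩
      exact (h2 _).2 (h _ (by simp at hi ⊢; omega))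
  constructor
  · rintro ⟨m, Q, ψ, k, hψ, hφ, hk, hs⟩
    have hmin : ∀ i : Fin m, min k m ≤ (i : ℕ) ↔ k ≤ (i : ℕ) := fun i => by omega
    refine ⟨m, Q, ψ, _, min k m, rfl, min_le_right _ _, hψ, hφ, ?_, ?_⟩
    · rw [hT]
      exact fun i hi => hk i (by omega)
    · simp only [hX, hY, hmin]
      exact hs
  · rintro ⟨m, Q, ψ, _, k, rfl, -, hψ, hφ, hk, hs⟩
    rw [hX, hY] at hs
    exact ⟨m, Q, ψ, k, hψ, hφ, (hT Q k).1 hk, hs⟩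

/-! ### Evaluation in finite structures -/

/-- The value of a term in the structure with the universe `{0, …, D - 1}` and the constants `cs`,
under the assignment `e`. -/
def termVal (cs e : List ℕ) (t : ℕ) : ℕ :=
  if t % 2 = 0 then e.getD (t / 2) 0 else cs.getD (t / 2) 0

/-- The truth of an atom under the assignment `e` in the structure with the constants `cs` in which
exactly the ground atoms `R(args)` with `(R, args) ∈ T` hold. -/
def AtomTrue (cs : List ℕ) (T : List (ℕ × List ℕ)) (e : List ℕ) (a : ℕ) : Prop :=
  if a % 4 = 1 then termVal cs e (a / 4).unpair.1 = termVal cs e (a / 4).unpair.2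
  else ((a / 4).unpair.1, (atomArgs a).map (termVal cs e)) ∈ T

open scoped Classical in
/-- The truth value of a quantifier-free formula in a finite structure. -/
noncomputable def matrixEval (cs : List ℕ) (T : List (ℕ × List ℕ)) (e : List ℕ) : ℕ → Bool :=
  matrixFold (fun a => decide (AtomTrue cs T e a)) (fun x y => !x || y) false

/-- All lists of `n` entries from `A`. -/
def tuples {α : Type} (A : List α) : ℕ → List (List α)
  | 0 => [[]]
  | n + 1 => A.flatMap fun a => (tuples A n).map (a :: ·)

theorem mem_tuples {α : Type} {A : List α} {n : ℕ} {l : List α} :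
    l ∈ tuples A n ↔ l.length = n ∧ ∀ a ∈ l, a ∈ A := by
  induction n generalizing l with
  | zero => cases l <;> simp [tuples]
  | succ n ih =>
    cases l with
    | nil => simp [tuples]
    | cons b l => simp [tuples, ih]; tauto

/-- All sublists of a list: each entry is either kept or dropped. -/
def selections {α : Type} (l : List α) : List (List α) :=
  l.foldr (fun a r => r ++ r.map (a :: ·)) [[]]

theorem filter_mem_selections {α : Type} (l : List α) (p : α → Bool) :
    l.filter p ∈ selections l := by
  induction l with
  | nil => simp [selections]
  | cons a l ih =>
    simp only [selections, List.foldr_cons, List.mem_append, List.mem_map, List.filter_cons] at *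
    split_ifs
    · exact Or.inr ⟨_, ih, rfl⟩
    · exact Or.inl ih

open scoped Classical in
/-- From the list of the assignments (innermost value first) over `{0, …, D - 1}` that satisfy `ψ`,
the list of those that satisfy `∃ v. ψ` (for `true`) or `∀ v. ψ` (for `false`). -/
noncomputable def quantStep (D : ℕ) (b : Bool) (E : List (List ℕ)) : List (List ℕ) :=
  bif b then E.map List.tail
  else (E.map List.tail).filter fun e => decide (∀ a < D, a :: e ∈ E)

/-- The list of the satisfying assignments of a quantifier-free formula, innermost value first. -/
noncomputable def solutions (D m : ℕ) (cs : List ℕ) (T : List (ℕ × List ℕ)) (p : ℕ) :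
    List (List ℕ) :=
  (tuples (List.range D) m).filter fun e => matrixEval cs T e.reverse p

/-- The truth of a prenex sentence in a finite structure. -/
def PrenexTrue (D : ℕ) (cs : List ℕ) (T : List (ℕ × List ℕ)) (l : List Bool) (p : ℕ) : Prop :=
  [] ∈ l.foldr (quantStep D) (solutions D l.length cs T p)

/-- Prepending to a list of values with the innermost one first assigns the next variable. -/
theorem getD_reverse_cons (a : ℕ) (e : List ℕ) :
    (fun i => (a :: e).reverse.getD i 0) =
      Function.update (fun i => e.reverse.getD i 0) e.length a := by
  funext i
  simp only [List.reverse_cons, List.getD_eq_getElem?_getD]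
  rcases lt_trichotomy i e.length with h | rfl | h
  · rw [List.getElem?_append_left (by simpa using h), Function.update_of_ne h.ne]
  · simp
  · rw [Function.update_of_ne h.ne', List.getElem?_eq_none (by simp; omega),
      List.getElem?_eq_none (by simp; omega)]

/-- Processing the quantifiers from the innermost one outwards computes the truth of the prefix. -/
theorem nil_mem_foldr_quantStep {D : ℕ} (hD : 0 < D) (l : List Bool) (E : List (List ℕ))
    (P : (ℕ → ℕ) → Prop) (hE : ∀ e ∈ E, e.length = l.length ∧ ∀ a ∈ e, a < D)
    (hP : ∀ e : List ℕ, e.length = l.length → (∀ a ∈ e, a < D) →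
      (e ∈ E ↔ P fun i => e.reverse.getD i 0)) :
    [] ∈ l.foldr (quantStep D) E ↔ quantify (Set.Iio D) l 0 P fun _ => 0 := by
  induction l using List.reverseRecOn generalizing E P with
  | nil => simpa [quantify] using hP [] rfl (by simp)
  | append_singleton l b ih =>
    rw [List.foldr_append, quantify_append, Nat.zero_add]
    have hstep : ∀ e : List ℕ, e.length = l.length → (∀ a ∈ e, a < D) →
        (e ∈ quantStep D b E ↔
          quantify (Set.Iio D) [b] l.length P fun i => e.reverse.getD i 0) := by
      intro e he hlt
      have hcons : ∀ a < D, (a :: e ∈ E ↔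
          P (Function.update (fun i => e.reverse.getD i 0) l.length a)) := fun a ha => by
        rw [← he, ← getD_reverse_cons]
        exact hP _ (by simp [he]) (by simpa using ⟨ha, hlt⟩)
      have htail : e ∈ E.map List.tail ↔ ∃ a < D, a :: e ∈ E := by
        rw [List.mem_map]
        constructor
        · rintro ⟨e', he', rfl⟩
          obtain ⟨h1, h2⟩ := hE _ he'
          rcases e' with _ | ⟨a, e'⟩
          · simp at h1
          · exact ⟨a, h2 a (by simp), he'⟩
        · rintro ⟨a, -, ha⟩
          exact ⟨_, ha, rfl⟩
      cases b
      · simp only [quantStep, cond_false, List.mem_filter, decide_eq_true_eq, quantify,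
          Set.mem_Iio, htail]
        constructor
        · exact fun h a ha => (hcons a ha).1 (h.2 a ha)
        · intro h
          have h' : ∀ a < D, a :: e ∈ E := fun a ha => (hcons a ha).2 (h a ha)
          exact ⟨⟨0, hD, h' 0 hD⟩, h'⟩
      · simp only [quantStep, cond_true, quantify, Set.mem_Iio, htail]
        exact exists_congr fun a => and_congr_right fun ha => hcons a ha
    refine ih (quantStep D b E) _ ?_ hstep
    intro e he
    have he' : e ∈ E.map List.tail := by
      cases b
      · exact List.mem_of_mem_filter he
      · exact he
    obtain ⟨e', h', rfl⟩ := List.mem_map.1 he'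
    obtain ⟨h1, h2⟩ := hE _ h'
    exact ⟨by simp [h1], fun a ha => h2 a (List.mem_of_mem_tail ha)⟩

theorem prenexTrue_iff {D : ℕ} (hD : 0 < D) (cs : List ℕ) (T : List (ℕ × List ℕ)) (l : List Bool)
    (p : ℕ) (P : (ℕ → ℕ) → Prop)
    (hP : ∀ e : List ℕ, e.length = l.length → (∀ a ∈ e, a < D) →
      (matrixEval cs T e p = true ↔ P fun i => e.getD i 0)) :
    PrenexTrue D cs T l p ↔ quantify (Set.Iio D) l 0 P fun _ => 0 := by
  refine nil_mem_foldr_quantStep hD l _ P ?_ ?_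
  · intro e he
    simpa [mem_tuples] using (mem_tuples.1 (List.mem_of_mem_filter he))
  · intro e he hlt
    rw [solutions, List.mem_filter, ← hP e.reverse (by simpa using he) (by simpa using hlt),
      mem_tuples]
    exact and_iff_right ⟨he, by simpa using hlt⟩

theorem termVal_var {cs e : List ℕ} {m : ℕ} (i : Fin m) :
    termVal cs e (termCode (.var (Sum.inr i) : signature.Term (Empty ⊕ Fin m))) = e.getD i 0 := by
  simp [termVal, termCode]

/-- The interpretation of the constant symbols in a structure. -/
abbrev constVal (M : Type) [signature.Structure M] (c : ℕ) : M :=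
  FirstOrder.Language.Structure.funMap (L := signature) (FunctionSymbol.const c) Fin.elim0

/-- The interpretation of the predicate symbols in a structure. -/
abbrev RelTrue (M : Type) [signature.Structure M] {n : ℕ} (R : ℕ) (x : Fin n → M) : Prop :=
  FirstOrder.Language.Structure.RelMap (L := signature) (R : signature.Relations n) x

/-- Together with the monotonicity of pairing, this bounds the numbers of the symbols in an atom by
its Gödel number. -/
theorem mem_le_encode (l : List ℕ) : ∀ a ∈ l, a ≤ Encodable.encode l := by
  induction l with
  | nil => simp
  | cons b l ih =>
    intro a ha
    have h1 := Nat.left_le_pair b (Encodable.encode l)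
    have h2 := Nat.right_le_pair b (Encodable.encode l)
    rw [Encodable.encode_list_cons]
    rcases List.mem_cons.1 ha with rfl | ha
    · exact h1.trans (Nat.le_succ _)
    · exact (ih a ha).trans (h2.trans (Nat.le_succ _))

section Presentation

variable {M : Type} [signature.Structure M]

/-- The numbers below `D`, named by `g`, with the constants `cs` and the list `T` of true ground
atoms present a substructure of `M`, as far as symbols and arities up to `c` are concerned. -/
structure Presents (g : ℕ → M) (D : ℕ) (cs : List ℕ) (T : List (ℕ × List ℕ)) (c : ℕ) : Prop where
  injOn : Set.InjOn g (Set.Iio D)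
  cs_lt : ∀ i ≤ c, cs.getD i 0 < D
  const : ∀ i ≤ c, g (cs.getD i 0) = constVal M i
  rel : ∀ n ≤ c, ∀ R ≤ c, ∀ x : Fin n → ℕ, (∀ j, x j < D) →
    ((R, List.ofFn x) ∈ T ↔ RelTrue M R (g ∘ x))

variable {g : ℕ → M} {D : ℕ} {cs : List ℕ} {T : List (ℕ × List ℕ)} {c : ℕ}

theorem Presents.termVal_spec (h : Presents g D cs T c) {m : ℕ} {e : List ℕ} (he : e.length = m)
    (hlt : ∀ a ∈ e, a < D) (t : signature.Term (Empty ⊕ Fin m)) (ht : termCode t ≤ c) :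
    termVal cs e (termCode t) < D ∧ g (termVal cs e (termCode t)) =
      t.realize (Sum.elim default fun i : Fin m => g (e.getD i 0)) := by
  rcases t with (x | i) | ⟨⟨k⟩, a⟩
  · exact x.elim
  · rw [termVal_var]
    refine ⟨hlt _ ?_, rfl⟩
    have hi : (i : ℕ) < e.length := he.symm ▸ i.2
    rw [List.getD_eq_getElem _ _ hi]
    exact List.getElem_mem hi
  · have e1 : termVal cs e (termCode (.func (FunctionSymbol.const k) a :
        signature.Term (Empty ⊕ Fin m))) = cs.getD k 0 := by
      have : (2 * k + 1) / 2 = k := by omega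
      simp only [termVal, termCode, this]
      rw [if_neg (by omega)]
    have hk : k ≤ c := by simp only [termCode] at ht; omega
    rw [e1]
    refine ⟨h.cs_lt k hk, (h.const k hk).trans ?_⟩
    exact congrArg (FirstOrder.Language.Structure.funMap (L := signature) (FunctionSymbol.const k))
      (Subsingleton.elim (α := Fin 0 → M) _ _)

open scoped Classical in
theorem Presents.matrixEval_rel_iff (h : Presents g D cs T c) {m n : ℕ} (R : ℕ)
    (ts : Fin n → signature.Term (Empty ⊕ Fin m)) (hc : code (.rel (l := n) R ts : Fml m) ≤ c)
    {e : List ℕ} (he : e.length = m) (hlt : ∀ a ∈ e, a < D) :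
    matrixEval cs T e (code (.rel (l := n) R ts : Fml m)) = true ↔
      (.rel (l := n) R ts : Fml m).Realize default fun i : Fin m => g (e.getD i 0) := by
  change 4 * Nat.pair R (Encodable.encode (List.ofFn fun j => termCode (ts j))) + 2 ≤ c at hc
  set args := List.ofFn fun j => termCode (ts j) with hargs
  have h1 := Nat.left_le_pair R (Encodable.encode args)
  have h2 := Nat.right_le_pair R (Encodable.encode args)
  have h3 : n ≤ Encodable.encode args := by
    simpa [hargs] using Encodable.length_le_encode args
  have hts : ∀ j, termCode (ts j) ≤ c := fun j => by
    have := mem_le_encode args (termCode (ts j)) (by simp [hargs])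
    omega
  have hv := fun j => h.termVal_spec he hlt (ts j) (hts j)
  change matrixFold _ _ _ (4 * Nat.pair R (Encodable.encode args) + 2) = true ↔ _
  have hq : (4 * Nat.pair R (Encodable.encode args) + 2) / 4 =
    Nat.pair R (Encodable.encode args) := by omega
  have hmap : args.map (termVal cs e) = List.ofFn fun j => termVal cs e (termCode (ts j)) := by
    rw [hargs, List.map_ofFn]; rfl
  rw [matrixFold_rel, decide_eq_true_eq, AtomTrue, if_neg (by omega), hq, Nat.unpair_pair,
    atomArgs_rel, hmap]
  refine (h.rel n (by omega) R (by omega) _ fun j => (hv j).1).trans ?_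
  exact iff_of_eq (congrArg (RelTrue M R) (funext fun j => (hv j).2))

open scoped Classical in
/-- Equations are evaluated correctly since distinct numbers name distinct elements of `M`. -/
theorem Presents.matrixEval_iff (h : Presents g D cs T c) {m : ℕ} {ψ : Fml m} (hψ : ψ.IsQF)
    (hc : code ψ ≤ c) {e : List ℕ} (he : e.length = m) (hlt : ∀ a ∈ e, a < D) :
    matrixEval cs T e (code ψ) = true ↔
      ψ.Realize default fun i : Fin m => g (e.getD i 0) := by
  induction hψ with
  | falsum => exact iff_of_false (by rw [matrixEval, code, matrixFold_zero]; simp) id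
  | of_isAtomic hat =>
    cases hat with
    | equal s t =>
      change 4 * Nat.pair (termCode s) (termCode t) + 1 ≤ c at hc
      have h1 := Nat.left_le_pair (termCode s) (termCode t)
      have h2 := Nat.right_le_pair (termCode s) (termCode t)
      obtain ⟨hs, hs'⟩ := h.termVal_spec he hlt s (by omega)
      obtain ⟨ht, ht'⟩ := h.termVal_spec he hlt t (by omega)
      change matrixFold _ _ _ (4 * Nat.pair (termCode s) (termCode t) + 1) = true ↔ _
      have hq : (4 * Nat.pair (termCode s) (termCode t) + 1) / 4 =
        Nat.pair (termCode s) (termCode t) := by omega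
      rw [matrixFold_equal, decide_eq_true_eq, AtomTrue, if_pos (by omega), hq, Nat.unpair_pair,
        FirstOrder.Language.BoundedFormula.realize_bdEqual, ← hs', ← ht']
      exact (h.injOn.eq_iff hs ht).symm
    | @rel n R ts =>
      exact h.matrixEval_rel_iff R ts hc he hlt
  | @imp φ₁ φ₂ _ _ ih₁ ih₂ =>
    change 4 * Nat.pair (code φ₁) (code φ₂) + 3 ≤ c at hc
    have h1 := Nat.left_le_pair (code φ₁) (code φ₂)
    have h2 := Nat.right_le_pair (code φ₁) (code φ₂)
    change matrixFold _ _ _ (4 * Nat.pair (code φ₁) (code φ₂) + 3) = true ↔ _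
    rw [matrixFold_imp, FirstOrder.Language.BoundedFormula.realize_imp, ← ih₁ (by omega),
      ← ih₂ (by omega)]
    simp only [matrixEval, Bool.or_eq_true, Bool.not_eq_true', imp_iff_not_or, Bool.not_eq_true]

end Presentation

theorem realize_prenex {M : Type} [signature.Structure M] {m : ℕ} (Q : Fin m → Quantifier)
    (ψ : Fml m) (u : ℕ → M) :
    M ⊨ prenex Q ψ ↔ quantify Set.univ (List.ofFn fun i => (Q i).isEx) 0
      (fun v => ψ.Realize default fun i : Fin m => v i) u := by
  induction m with
  | zero =>
    simp only [List.ofFn_zero, quantify, prenex]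
    rw [Subsingleton.elim (fun i : Fin 0 => u i) default]
    rfl
  | succ m ih =>
    rw [prenex, ih, List.ofFn_succ_last, quantify_append]
    refine quantify_congr (fun v => ?_) _ _ _
    have hsnoc : ∀ a, (fun i : Fin (m + 1) => Function.update v m a i) =
        Fin.snoc (α := fun _ => M) (fun i : Fin m => v i) a := fun a => by
      funext i
      refine Fin.lastCases ?_ (fun j => ?_) i
      · simp
      · simp [Function.update_of_ne j.2.ne]
    cases h : Q (Fin.last m) <;>
      simp [quantify, Quantifier.isEx, hsnoc, FirstOrder.Language.BoundedFormula.realize_all,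
        FirstOrder.Language.BoundedFormula.realize_ex]

/-! ### Small models of sentences of the Separated Fragment -/

theorem realize_congr_of_termVars {M : Type} [signature.Structure M] {m : ℕ}
    (t : signature.Term (Empty ⊕ Fin m)) {u u' : Fin m → M} (h : ∀ i ∈ termVars t, u i = u' i) :
    t.realize (Sum.elim default u) = t.realize (Sum.elim default u') := by
  rcases t with (x | i) | ⟨⟨k⟩, a⟩
  · exact x.elim
  · exact h i ((mem_termVars _ _).2 rfl)
  · exact congrArg (FirstOrder.Language.Structure.funMap (L := signature) (FunctionSymbol.const k))
      (Subsingleton.elim (α := Fin 0 → M) _ _)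

/-- The truth of `χ` in `M` does not depend on the values of the variables in `X`. -/
def IndependentOf (M : Type) [signature.Structure M] {m : ℕ} (X : Set (Fin m)) (χ : Fml m) : Prop :=
  ∀ v v' : Fin m → M, (∀ i ∉ X, v i = v' i) → (χ.Realize default v ↔ χ.Realize default v')

/-- In a separated formula the values of the variables in `Z` matter only for the atoms without
variables from `X`. -/
theorem realize_iff_of_separated {M : Type} [signature.Structure M] {m : ℕ} {X Z : Set (Fin m)}
    {u u' : Fin m → M} {c : ℕ} (hu : ∀ i ∉ Z, u i = u' i)
    (hc : ∀ χ : Fml m, code χ ≤ c → IndependentOf M X χ →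
      (χ.Realize default u ↔ χ.Realize default u')) {ψ : Fml m} (hψ : ψ.IsQF)
    (hs : Separated X Z ψ) (hψc : code ψ ≤ c) :
    ψ.Realize default u ↔ ψ.Realize default u' := by
  have key : ∀ (χ : Fml m) (V : Set (Fin m)), code χ ≤ c →
      (∀ v v' : Fin m → M, (∀ i ∈ V, v i = v' i) → (χ.Realize default v ↔ χ.Realize default v')) →
      V ∩ X = ∅ ∨ V ∩ Z = ∅ → (χ.Realize default u ↔ χ.Realize default u') := by
    rintro χ V hχ hV (h | h)
    · refine hc χ hχ fun v v' hv => hV v v' fun i hi => hv i fun hX => ?_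
      exact Set.eq_empty_iff_forall_notMem.1 h i ⟨hi, hX⟩
    · exact hV u u' fun i hi => hu i fun hZ => Set.eq_empty_iff_forall_notMem.1 h i ⟨hi, hZ⟩
  induction hψ with
  | falsum => exact Iff.rfl
  | of_isAtomic hat =>
    cases hat with
    | equal s t =>
      refine key _ _ hψc (fun v v' hv => ?_) hs
      rw [FirstOrder.Language.BoundedFormula.realize_bdEqual,
        FirstOrder.Language.BoundedFormula.realize_bdEqual,
        realize_congr_of_termVars s fun i hi => hv i (Or.inl hi),
        realize_congr_of_termVars t fun i hi => hv i (Or.inr hi)]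
    | rel R ts =>
      refine key _ _ hψc (fun v v' hv => ?_) hs
      rw [FirstOrder.Language.BoundedFormula.realize_rel,
        FirstOrder.Language.BoundedFormula.realize_rel]
      have : ∀ j, (ts j).realize (Sum.elim default v) = (ts j).realize (Sum.elim default v') :=
        fun j => realize_congr_of_termVars (ts j) fun i hi => hv i (Set.mem_iUnion.2 ⟨j, hi⟩)
      simp only [this]
  | @imp φ₁ φ₂ _ _ ih₁ ih₂ =>
    change 4 * Nat.pair (code φ₁) (code φ₂) + 3 ≤ c at hψc
    have h1 := Nat.left_le_pair (code φ₁) (code φ₂)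
    have h2 := Nat.right_le_pair (code φ₁) (code φ₂)
    exact imp_congr (ih₁ hs.1 (by omega)) (ih₂ hs.2 (by omega))

/-- The formulas with Gödel numbers up to `c` that do not depend on the variables in `X` and are
true under the assignment `u`. -/
def profile (M : Type) [signature.Structure M] {m : ℕ} (X : Set (Fin m)) (c : ℕ) (u : ℕ → M) :
    Set (Fin (c + 1)) :=
  {a | ∃ χ : Fml m, code χ = a ∧ IndependentOf M X χ ∧ χ.Realize default fun i : Fin m => u i}

theorem mem_profile {M : Type} [signature.Structure M] {m : ℕ} {X : Set (Fin m)} {c : ℕ}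
    {u : ℕ → M} {χ : Fml m} (hc : code χ ≤ c) (hχ : IndependentOf M X χ) :
    (⟨code χ, Nat.lt_succ_of_le hc⟩ : Fin (c + 1)) ∈ profile M X c u ↔
      χ.Realize default fun i : Fin m => u i := by
  constructor
  · rintro ⟨χ', h, -, h'⟩
    rwa [code_injective h] at h'
  · exact fun h => ⟨χ, rfl, hχ, h⟩

/-- A bound for the size of the least model of a satisfiable sentence of the Separated Fragment with
the Gödel number `c`. -/
def modelBound (c : ℕ) : ℕ := (sizes (2 ^ (c + 1)) c).2 + (c + 1)

/-- All ground atoms over `{0, …, D - 1}` of a predicate symbol and of an arity up to `c`. -/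
def groundAtoms (D c : ℕ) : List (ℕ × List ℕ) :=
  (List.range (c + 1)).flatMap fun R =>
    (List.range (c + 1)).flatMap fun n => (tuples (List.range D) n).map fun x => (R, x)

theorem mem_groundAtoms {D c R n : ℕ} (hn : n ≤ c) (hR : R ≤ c) {x : Fin n → ℕ}
    (hx : ∀ j, x j < D) : (R, List.ofFn x) ∈ groundAtoms D c := by
  simp only [groundAtoms, List.mem_flatMap, List.mem_range, List.mem_map, Nat.lt_succ_iff]
  refine ⟨R, hR, n, hn, _, mem_tuples.2 ⟨List.length_ofFn, ?_⟩, rfl⟩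
  simpa using hx

/-- A finite set `S` containing the constants with numbers up to `c` carries a substructure, as far as
symbols up to `c` are concerned, which can be presented on `{0, …, |S| - 1}`. -/
theorem exists_presents {M : Type} [signature.Structure M] (S : Finset M) (c : ℕ)
    (hS : ∀ i ≤ c, constVal M i ∈ S) :
    ∃ g : ℕ → M, ∃ cs ∈ tuples (List.range S.card) (c + 1),
      ∃ T ∈ selections (groundAtoms S.card c),
        Presents g S.card cs T c ∧ g '' Set.Iio S.card = S := by
  classical
  let e := S.equivFin
  let g : ℕ → M := fun i => if h : i < S.card then (e.symm ⟨i, h⟩ : M) else constVal M 0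
  have hg : ∀ i (h : i < S.card), g i = e.symm ⟨i, h⟩ := fun i h => dif_pos h
  have hsurj : ∀ x ∈ S, ∃ i < S.card, g i = x := fun x hx =>
    ⟨e ⟨x, hx⟩, (e ⟨x, hx⟩).2, by rw [hg _ (e ⟨x, hx⟩).2]; simp⟩
  have hidx : ∀ i, ∃ j, i ≤ c → j < S.card ∧ g j = constVal M i := by
    intro i
    by_cases hi : i ≤ c
    · obtain ⟨j, hj, hj'⟩ := hsurj _ (hS i hi)
      exact ⟨j, fun _ => ⟨hj, hj'⟩⟩
    · exact ⟨0, fun h => absurd h hi⟩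
  choose idx hidx using hidx
  have hcs : ∀ i ≤ c, ((List.range (c + 1)).map idx).getD i 0 = idx i := fun i hi => by
    simp [Nat.lt_succ_of_le hi]
  refine ⟨g, (List.range (c + 1)).map idx, mem_tuples.2 ⟨by simp, ?_⟩,
    (groundAtoms S.card c).filter fun a => decide (∃ (n : ℕ) (x : Fin n → ℕ),
      a.2 = List.ofFn x ∧ RelTrue M a.1 (g ∘ x)), filter_mem_selections _ _,
    ⟨?_, ?_, ?_, ?_⟩, ?_⟩
  · simp only [List.mem_map, List.mem_range]
    rintro _ ⟨i, hi, rfl⟩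
    exact (hidx i (Nat.le_of_lt_succ hi)).1
  · intro i hi j hj hij
    rw [hg i hi, hg j hj] at hij
    exact congrArg Fin.val (e.symm.injective (Subtype.ext hij))
  · intro i hi
    rw [hcs i hi]
    exact (hidx i hi).1
  · intro i hi
    rw [hcs i hi]
    exact (hidx i hi).2
  · intro n hn R hR x hx
    rw [List.mem_filter, decide_eq_true_eq]
    constructor
    · rintro ⟨-, n', x', hxx, h⟩
      have hxx : List.ofFn x = List.ofFn x' := hxx
      obtain rfl : n = n' := by simpa using congrArg List.length hxx
      rwa [← List.ofFn_injective hxx] at h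
    · exact fun h => ⟨mem_groundAtoms hn hR hx, n, x, rfl, h⟩
  · ext x
    constructor
    · rintro ⟨i, hi, rfl⟩
      rw [hg i hi]
      exact (e.symm ⟨i, hi⟩).2
    · exact fun hx => hsurj x hx

theorem Presents.prenexTrue_iff {M : Type} [signature.Structure M] {g : ℕ → M} {D : ℕ}
    {cs : List ℕ} {T : List (ℕ × List ℕ)} {c : ℕ} (h : Presents g D cs T c) (hD : 0 < D) {m : ℕ}
    {ψ : Fml m} (hψ : ψ.IsQF) (hc : code ψ ≤ c) {l : List Bool} (hl : l.length = m) :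
    PrenexTrue D cs T l (code ψ) ↔
      quantify (g '' Set.Iio D) l 0 (fun v => ψ.Realize default fun i : Fin m => v i)
        fun _ => g 0 :=
  (SeparatedFragment.prenexTrue_iff hD cs T l (code ψ)
    (fun v => ψ.Realize default fun i : Fin m => g (v i))
    fun _ he hlt => h.matrixEval_iff hψ hc (he.trans hl) hlt).trans
  (quantify_image g (Set.Iio D) (fun v => ψ.Realize default fun i : Fin m => v i) l 0
    fun _ => 0).symm

/-- A sentence of the Separated Fragment with a model is true in a finite structure of bounded
size. -/
theorem exists_prenexTrue {M : Type} [signature.Structure M] [Nonempty M] {m : ℕ}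
    {Q : Fin m → Quantifier} {ψ : Fml m} {l : List Bool} {k c : ℕ}
    (hl : l = List.ofFn fun i => (Q i).isEx) (hkm : k ≤ m) (hψ : ψ.IsQF)
    (hk : ∀ b ∈ l.take k, b = true) (hs : Separated (univVars l m) (exVars l k m) ψ)
    (hM : M ⊨ prenex Q ψ) (hm : m ≤ c) (hc : code ψ ≤ c) :
    ∃ D < modelBound c + 1, 0 < D ∧ ∃ cs ∈ tuples (List.range D) (c + 1),
      ∃ T ∈ selections (groundAtoms D c), PrenexTrue D cs T l (code ψ) := by
  classical
  obtain ⟨u₀⟩ := ‹Nonempty M›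
  have hlm : l.length = m := by simp [hl]
  set P : (ℕ → M) → Prop := fun v => ψ.Realize default fun i : Fin m => v i
  have hβ : ∀ u u' : ℕ → M, (∀ j ∉ {j | l[j]? = some false}, u j = u' j) →
      profile M (univVars l m) c u = profile M (univVars l m) c u' := by
    intro u u' hu
    ext a
    refine exists_congr fun χ => and_congr_right fun _ => and_congr_right fun hχ => ?_
    exact hχ _ _ fun i hi => hu i hi
  have hP : ∀ u u' : ℕ → M, (∀ j ∉ {j | k ≤ j ∧ l[j]? = some true}, u j = u' j) →
      profile M (univVars l m) c u = profile M (univVars l m) c u' → P u → P u' := by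
    intro u u' hu hp
    refine (realize_iff_of_separated (c := c) (fun i hi => hu i hi) (fun χ hχ hi => ?_) hψ hs hc).1
    rw [← mem_profile hχ hi, ← mem_profile hχ hi, hp]
  have hsplit := List.take_append_drop k l
  have hlen : (l.take k).length = k := by simp [hlm, hkm]
  have hprefix : ∀ u, quantify Set.univ (l.take k ++ l.drop k) 0 P u := fun u => by
    rw [hsplit, hl]
    exact (realize_prenex Q ψ u).1 hM
  obtain ⟨S₀, hS₀, hS⟩ := exists_finset_quantify (zs := l.take k) (qs := l.drop k) (i := 0)
    (u := fun _ => u₀) hβ hP hk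
    (fun j hj => by rw [List.getElem?_drop] at hj; simpa [hlen] using hj)
    (fun j hj => by rw [List.getElem?_drop] at hj; simpa [hlen] using hj) (hprefix _)
  -- The constants with numbers up to `c` include all that occur in `ψ`.
  set S : Finset M := S₀ ∪ (Finset.range (c + 1)).image (constVal M) with hSdef
  have hconst : ∀ i ≤ c, constVal M i ∈ S := fun i hi =>
    Finset.mem_union_right _ (Finset.mem_image_of_mem _ (Finset.mem_range.2 (Nat.lt_succ_of_le hi)))
  have hpos : 0 < S.card := Finset.card_pos.2 ⟨_, hconst 0 (Nat.zero_le _)⟩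
  have hcard : S.card ≤ modelBound c := by
    refine (Finset.card_union_le _ _).trans (Nat.add_le_add (hS₀.trans ?_) ?_)
    · have hY : Nat.card (Set (Fin (c + 1))) = 2 ^ (c + 1) := by simp
      rw [hY, ← List.length_append, hsplit, hlm]
      exact sizes_snd_mono (Nat.two_pow_pos _) hm
    · exact Finset.card_image_le.trans (by simp)
  obtain ⟨g, cs, hcs, T, hT, hpres, hg⟩ := exists_presents S c hconst
  refine ⟨S.card, Nat.lt_succ_of_le hcard, hpos, cs, hcs, T, hT, ?_⟩
  rw [hpres.prenexTrue_iff hpos hψ hc hlm, hg]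
  have := hS S (Finset.coe_subset.2 Finset.subset_union_left)
  rw [hsplit] at this
  refine (quantify_congr_start (fun v v' h => ?_) (by simp)).1 this
  have : (fun i : Fin m => v i) = fun i : Fin m => v' i :=
    funext fun i => h i (by rw [Nat.zero_add, hlm]; exact i.2)
  simp only [this]

/-- A finite structure in which a prenex sentence evaluates to true is a model of it. -/
theorem isSatisfiable_of_prenexTrue {D n : ℕ} {cs : List ℕ} {T : List (ℕ × List ℕ)} (hD : 0 < D)
    (hcs : cs ∈ tuples (List.range D) n) {m : ℕ} {Q : Fin m → Quantifier} {ψ : Fml m}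
    {l : List Bool} (hl : l = List.ofFn fun i => (Q i).isEx) (hψ : ψ.IsQF)
    (h : PrenexTrue D cs T l (code ψ)) :
    FirstOrder.Language.Theory.IsSatisfiable ({prenex Q ψ} : signature.Theory) := by
  have hlt : ∀ i, cs.getD i 0 < D := fun i => by
    rcases lt_or_ge i cs.length with hi | hi
    · rw [List.getD_eq_getElem _ _ hi]
      simpa using (mem_tuples.1 hcs).2 _ (List.getElem_mem hi)
    · rwa [List.getD_eq_default _ _ hi]
  let funs : ∀ {k : ℕ}, FunctionSymbol k → Fin D := fun f =>
    match f with
    | .const i => ⟨cs.getD i 0, hlt i⟩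
  let _ : signature.Structure (Fin D) :=
    { funMap := fun f _ => funs f
      RelMap := fun R x => ((R : ℕ), List.ofFn fun j => (x j : ℕ)) ∈ T }
  have : Nonempty (Fin D) := ⟨⟨0, hD⟩⟩
  -- Only the values of `g` below `D` matter, and on those it is the identity.
  let g : ℕ → Fin D := fun i => ⟨i % D, Nat.mod_lt _ hD⟩
  have hg : ∀ i < D, (g i : ℕ) = i := fun i hi => Nat.mod_eq_of_lt hi
  have hpres : Presents g D cs T (code ψ) :=
    { injOn := fun i hi j hj hij => by rw [← hg i hi, ← hg j hj, hij]
      cs_lt := fun i _ => hlt i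
      const := fun i _ => Fin.ext (hg _ (hlt i))
      rel := fun k _ R _ x hx => by
        have : (fun j => ((g ∘ x) j : ℕ)) = x := funext fun j => hg _ (hx j)
        change _ ↔ (R, List.ofFn fun j => ((g ∘ x) j : ℕ)) ∈ T
        rw [this] }
  have himage : g '' Set.Iio D = Set.univ :=
    Set.eq_univ_of_forall fun x => ⟨x, x.2, Fin.ext (hg _ x.2)⟩
  rw [hpres.prenexTrue_iff hD hψ le_rfl (by simp [hl]), himage, hl] at h
  have hmodel : Fin D ⊨ prenex Q ψ := (realize_prenex Q ψ _).2 h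
  have : Fin D ⊨ ({prenex Q ψ} : signature.Theory) :=
    FirstOrder.Language.Theory.model_singleton_iff.2 hmodel
  exact FirstOrder.Language.Theory.Model.isSatisfiable (Fin D)

/-- The criterion for satisfiability as a bounded search: for a prefix `l`, for the Gödel number `p`
of a matrix and for the number `k` of leading existential quantifiers, and then for a finite
structure. -/
theorem exists_satisfiable_iff (c : ℕ) :
    (∃ φ : signature.Sentence, code φ = c ∧ IsSF φ ∧
      FirstOrder.Language.Theory.IsSatisfiable ({φ} : signature.Theory)) ↔
    ∃ n < c + 1, ∃ l ∈ tuples [false, true] n, ∃ p < c + 1, ∃ k < c + 1,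
      (prefixCode l p = c ∧ matrixOK l k p = true ∧ ∀ b ∈ l.take k, b = true) ∧
      ∃ D < modelBound c + 1, 0 < D ∧ ∃ cs ∈ tuples (List.range D) (c + 1),
        ∃ T ∈ selections (groundAtoms D c), PrenexTrue D cs T l p := by
  constructor
  · rintro ⟨φ, rfl, hSF, ⟨M⟩⟩
    obtain ⟨m, Q, ψ, l, k, hl, hkm, hψ, rfl, hk, hs⟩ := (isSF_iff φ).1 hSF
    have hlm : l.length = m := by simp [hl]
    have hcode : code (prenex Q ψ) = prefixCode l (code ψ) := by rw [code_prenex, hl]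
    have hle := le_prefixCode l (code ψ)
    rw [← hcode, hlm] at hle
    refine ⟨m, by omega, l, mem_tuples.2 ⟨hlm, by simp⟩, code ψ, by omega, k, by omega,
      ⟨hcode.symm, matrixOK_code hlm hψ hs, hk⟩, ?_⟩
    exact exists_prenexTrue (M := M) hl hkm hψ hk hs
      (FirstOrder.Language.Theory.model_singleton_iff.1 M.is_model) (by omega) (by omega)
  · rintro ⟨n, -, l, -, p, -, k, -, ⟨hp, hok, hk⟩, D, -, hD, cs, hcs, T, -, hT⟩
    obtain ⟨ψ, hψ, rfl, hs⟩ := exists_code_eq_of_matrixOK (m := l.length) rfl p hok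
    let Q : Fin l.length → Quantifier := fun i => bif l.get i then .ex else .all
    have hl : l = List.ofFn fun i => (Q i).isEx := by
      have : (fun i => (Q i).isEx) = l.get := by
        funext i
        simp only [Q]
        cases l.get i <;> rfl
      rw [this, List.ofFn_get]
    refine ⟨prenex Q ψ, by rw [code_prenex, ← hl, hp], ?_,
      isSatisfiable_of_prenexTrue hD hcs hl hψ hT⟩
    -- If `k` exceeds the length of the prefix, all quantifiers are existential.
    by_cases hkl : k ≤ l.length
    · exact (isSF_iff _).2 ⟨_, Q, ψ, l, k, hl, hkl, hψ, rfl, hk, hs⟩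
    · refine (isSF_iff _).2 ⟨_, Q, ψ, l, l.length, hl, le_rfl, hψ, rfl, ?_, ?_⟩
      · rwa [List.take_of_length_le le_rfl, ← List.take_of_length_le (by omega : l.length ≤ k)]
      · have : exVars l l.length l.length = exVars l k l.length := by
          ext i
          simp only [exVars, Set.mem_ofPred_eq]
          omega
        rwa [this]

/-! ### Primitive recursiveness of the search -/

section Prim

open Primrec

variable {α β : Type} [Primcodable α] [Primcodable β]

theorem primrecPred_exists_mem {L : α → List β} {p : α → β → Prop} (hL : Primrec L)
    (hp : PrimrecRel p) : PrimrecPred fun a => ∃ b ∈ L a, p a b :=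
  hp.swap.exists_mem_list.comp hL Primrec.id

theorem primrecPred_forall_mem {L : α → List β} {p : α → β → Prop} (hL : Primrec L)
    (hp : PrimrecRel p) : PrimrecPred fun a => ∀ b ∈ L a, p a b :=
  hp.swap.forall_mem_list.comp hL Primrec.id

theorem primrecPred_exists_lt {f : α → ℕ} {p : α → ℕ → Prop} (hf : Primrec f)
    (hp : PrimrecRel p) : PrimrecPred fun a => ∃ n < f a, p a n :=
  (primrecPred_exists_mem (list_range.comp hf) hp).of_eq fun a => by simp

theorem primrecPred_forall_lt {f : α → ℕ} {p : α → ℕ → Prop} (hf : Primrec f)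
    (hp : PrimrecRel p) : PrimrecPred fun a => ∀ n < f a, p a n :=
  (primrecPred_forall_mem (list_range.comp hf) hp).of_eq fun a => by simp

theorem primrec_filter {L : α → List β} {p : α → β → Prop} [DecidableRel p] (hL : Primrec L)
    (hp : PrimrecRel p) : Primrec fun a => (L a).filter fun b => decide (p a b) := by
  have : DecidableRel (Function.swap p) := fun b a => inferInstanceAs (Decidable (p a b))
  exact (hp.swap.listFilter.comp hL Primrec.id).of_eq fun a => by
    congr!

theorem primrecPred_imp {p q : α → Prop} (hp : PrimrecPred p) (hq : PrimrecPred q) :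
    PrimrecPred fun a => p a → q a :=
  (hp.not.or hq).of_eq fun _ => imp_iff_not_or.symm

theorem primrec_matrixFold {A : α → ℕ → Bool} (hA : Primrec₂ A) (op : Bool → Bool → Bool)
    (z : Bool) : Primrec₂ fun a n => matrixFold (A a) op z n := by
  have hunpair : Primrec fun x : (α × List Bool) × ℕ => (x.2 / 4).unpair :=
    Primrec.unpair.comp (nat_div.comp snd (const 4))
  have hmod : Primrec fun x : (α × List Bool) × ℕ => x.2 % 4 := nat_mod.comp snd (const 4)
  have hlist : Primrec fun x : (α × List Bool) × ℕ => x.1.2 := snd.comp fst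
  refine nat_strong_rec _
    (g := fun a L => Nat.casesOn L.length (some z) fun n =>
      if n % 4 = 2 then
        some (op (L.getD (n / 4).unpair.1 false) (L.getD (n / 4).unpair.2 false))
      else if n % 4 = 3 then some false else some (A a (n + 1))) ?_ ?_
  · refine nat_casesOn (list_length.comp snd) (const _) ?_
    refine Primrec.ite (Primrec.eq.comp hmod (const 2)) ?_
      (Primrec.ite (Primrec.eq.comp hmod (const 3)) (const _) ?_)
    · exact option_some.comp ((dom_bool₂ op).comp
        ((list_getD false).comp hlist (fst.comp hunpair))
        ((list_getD false).comp hlist (snd.comp hunpair)))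
    · exact option_some.comp (hA.comp (fst.comp fst) (succ.comp snd))
  · intro a n
    rcases n with _ | n
    · simp [matrixFold_zero]
    · have h1 : (n / 4).unpair.1 < n + 1 :=
        Nat.lt_succ_of_le ((Nat.unpair_left_le _).trans (Nat.div_le_self _ _))
      have h2 : (n / 4).unpair.2 < n + 1 :=
        Nat.lt_succ_of_le ((Nat.unpair_right_le _).trans (Nat.div_le_self _ _))
      rw [matrixFold]
      simp only [List.length_map, List.length_range, List.getD_eq_getElem?_getD, List.getElem?_map,
        List.getElem?_range h1, List.getElem?_range h2, Option.map_some, Option.getD_some]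
      split_ifs <;> rfl

theorem primrec_atomArgs : Primrec atomArgs := by
  have hunpair : Primrec fun a : ℕ => (a / 4).unpair :=
    Primrec.unpair.comp (nat_div.comp Primrec.id (const 4))
  refine Primrec.ite (Primrec.eq.comp (nat_mod.comp Primrec.id (const 4)) (const 1)) ?_
    ((Primrec.ofNat (List ℕ)).comp (snd.comp hunpair))
  exact list_cons.comp (fst.comp hunpair) (list_cons.comp (snd.comp hunpair) (const []))

theorem primrecRel_atomOK :
    PrimrecRel fun (x : List Bool × ℕ) (a : ℕ) => AtomOK x.1 x.2 a := by
  have hargs : Primrec fun x : (List Bool × ℕ) × ℕ => atomArgs x.2 := primrec_atomArgs.comp snd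
  have heven : PrimrecPred fun x : ((List Bool × ℕ) × ℕ) × ℕ => x.2 % 2 = 0 :=
    Primrec.eq.comp (nat_mod.comp snd (const 2)) (const 0)
  have hhalf : Primrec fun x : ((List Bool × ℕ) × ℕ) × ℕ => x.2 / 2 := nat_div.comp snd (const 2)
  have hl : Primrec fun x : ((List Bool × ℕ) × ℕ) × ℕ => x.1.1.1 := fst.comp (fst.comp fst)
  have hget : Primrec fun x : ((List Bool × ℕ) × ℕ) × ℕ => x.1.1.1[x.2 / 2]? :=
    list_getElem?.comp hl hhalf
  refine PrimrecPred.and ?_ (PrimrecPred.or ?_ ?_)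
  · exact primrecPred_forall_mem hargs
      (primrecPred_imp heven (nat_lt.comp hhalf (list_length.comp hl))).primrecRel
  · exact primrecPred_forall_mem hargs
      (primrecPred_imp heven (Primrec.eq.comp hget (const (some false))).not).primrecRel
  · exact primrecPred_forall_mem hargs (primrecPred_imp heven
      ((nat_le.comp (snd.comp (fst.comp fst)) hhalf).and
        (Primrec.eq.comp hget (const (some true)))).not).primrecRel

open scoped Classical in
theorem primrec_matrixOK :
    Primrec₂ fun (x : List Bool × ℕ) (p : ℕ) => matrixOK x.1 x.2 p :=
  primrec_matrixFold (A := fun (x : List Bool × ℕ) a => decide (AtomOK x.1 x.2 a))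
    primrecRel_atomOK.decide _ _

theorem primrec_termVal :
    Primrec fun x : (List ℕ × List ℕ) × ℕ => termVal x.1.1 x.1.2 x.2 := by
  have hhalf : Primrec fun x : (List ℕ × List ℕ) × ℕ => x.2 / 2 := nat_div.comp snd (const 2)
  exact Primrec.ite (Primrec.eq.comp (nat_mod.comp snd (const 2)) (const 0))
    ((list_getD 0).comp (snd.comp fst) hhalf) ((list_getD 0).comp (fst.comp fst) hhalf)

/-- The parameters of an evaluation: the constants, the true ground atoms and an assignment. -/
abbrev EvalParams := List ℕ × List (ℕ × List ℕ) × List ℕ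

theorem primrecRel_atomTrue :
    PrimrecRel fun (x : EvalParams) (a : ℕ) => AtomTrue x.1 x.2.1 x.2.2 a := by
  classical
  have hunpair : Primrec fun x : EvalParams × ℕ => (x.2 / 4).unpair :=
    Primrec.unpair.comp (nat_div.comp snd (const 4))
  have hce : Primrec fun x : EvalParams × ℕ => (x.1.1, x.1.2.2) :=
    (fst.comp fst).pair (snd.comp (snd.comp fst))
  have hval : ∀ {f : EvalParams × ℕ → ℕ}, Primrec f →
      Primrec fun x : EvalParams × ℕ => termVal x.1.1 x.1.2.2 (f x) := fun hf =>
    primrec_termVal.comp (hce.pair hf)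
  have hmap : Primrec fun x : EvalParams × ℕ => (atomArgs x.2).map (termVal x.1.1 x.1.2.2) :=
    list_map (primrec_atomArgs.comp snd) (primrec_termVal.comp ((hce.comp fst).pair snd)).to₂
  have hmod : PrimrecPred fun x : EvalParams × ℕ => x.2 % 4 = 1 :=
    Primrec.eq.comp (nat_mod.comp snd (const 4)) (const 1)
  have hmem : PrimrecPred fun x : EvalParams × ℕ =>
      ∃ b ∈ x.1.2.1, b = ((x.2 / 4).unpair.1, (atomArgs x.2).map (termVal x.1.1 x.1.2.2)) :=
    primrecPred_exists_mem (fst.comp (snd.comp fst))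
      (Primrec.eq.comp snd (((fst.comp hunpair).pair hmap).comp fst)).primrecRel
  refine PrimrecPred.of_eq ((hmod.and (Primrec.eq.comp (hval (fst.comp hunpair))
    (hval (snd.comp hunpair)))).or (hmod.not.and hmem)) fun x => ?_
  by_cases h : x.2 % 4 = 1 <;> simp [AtomTrue, h]

open scoped Classical in
theorem primrec_matrixEval :
    Primrec₂ fun (x : EvalParams) (p : ℕ) => matrixEval x.1 x.2.1 x.2.2 p :=
  primrec_matrixFold (A := fun (x : EvalParams) a => decide (AtomTrue x.1 x.2.1 x.2.2 a))
    primrecRel_atomTrue.decide _ _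

theorem primrec_tuples : Primrec₂ (tuples : List β → ℕ → List (List β)) := by
  refine (nat_rec (f := fun _ : List β => [[]])
    (g := fun A x => A.flatMap fun a => x.2.map (a :: ·)) (const _) ?_).of_eq fun A n => ?_
  · refine list_flatMap fst (list_map (snd.comp (snd.comp fst)) ?_)
    exact list_cons.comp (snd.comp fst) snd
  · induction n with
    | zero => rfl
    | succ n ih => simp only [ih, tuples]

theorem primrec_selections : Primrec (selections : List β → List (List β)) := by
  refine list_foldr (h := fun (_ : List β) (x : β × List (List β)) => x.2 ++ x.2.map (x.1 :: ·))
    Primrec.id (const _) ?_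
  refine list_append.comp (snd.comp snd) (list_map (snd.comp snd) ?_)
  exact list_cons.comp (fst.comp (snd.comp fst)) snd

theorem primrec_groundAtoms : Primrec₂ groundAtoms := by
  refine list_flatMap (list_range.comp (succ.comp snd)) ?_
  refine list_flatMap (list_range.comp (succ.comp (snd.comp fst))) ?_
  refine list_map (primrec_tuples.comp (list_range.comp (fst.comp (fst.comp fst))) snd) ?_
  exact (snd.comp (fst.comp fst)).pair snd

theorem primrec_quantStep :
    Primrec fun x : ℕ × Bool × List (List ℕ) => quantStep x.1 x.2.1 x.2.2 := by
  classical
  have htail : Primrec fun x : ℕ × Bool × List (List ℕ) => x.2.2.map List.tail :=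
    list_map (snd.comp snd) (list_tail.comp snd).to₂
  refine Primrec.cond (fst.comp snd) htail ?_
  refine primrec_filter (p := fun (x : ℕ × Bool × List (List ℕ)) e =>
    ∀ a < x.1, a :: e ∈ x.2.2) htail ?_
  refine primrecPred_forall_lt (fst.comp fst) ?_
  have : PrimrecPred fun x : ((ℕ × Bool × List (List ℕ)) × List ℕ) × ℕ =>
      ∃ b ∈ x.1.1.2.2, b = x.2 :: x.1.2 :=
    primrecPred_exists_mem (snd.comp (snd.comp (fst.comp fst)))
      (Primrec.eq.comp snd (list_cons.comp (snd.comp fst) (snd.comp (fst.comp fst)))).primrecRel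
  exact this.of_eq fun x => by simp

/-- A finite structure: the number of its elements, its constants and its true ground atoms. -/
abbrev StructureCode := ℕ × List ℕ × List (ℕ × List ℕ)

theorem primrec_solutions :
    Primrec fun x : StructureCode × ℕ × ℕ =>
      solutions x.1.1 x.2.1 x.1.2.1 x.1.2.2 x.2.2 := by
  have h : Primrec₂ fun (x : StructureCode × ℕ × ℕ) (e : List ℕ) =>
      matrixEval x.1.2.1 x.1.2.2 e.reverse x.2.2 :=
    primrec_matrixEval.comp ((fst.comp (snd.comp (fst.comp fst))).pair
      ((snd.comp (snd.comp (fst.comp fst))).pair (list_reverse.comp snd)))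
      (snd.comp (snd.comp fst))
  have hp : PrimrecRel fun (x : StructureCode × ℕ × ℕ) (e : List ℕ) =>
      matrixEval x.1.2.1 x.1.2.2 e.reverse x.2.2 = true := Primrec.eq.comp h (const true)
  refine (primrec_filter (primrec_tuples.comp (list_range.comp (fst.comp fst))
    (fst.comp snd)) hp).of_eq fun x => ?_
  simp [solutions]

theorem primrecPred_prenexTrue :
    PrimrecPred fun x : StructureCode × List Bool × ℕ =>
      PrenexTrue x.1.1 x.1.2.1 x.1.2.2 x.2.1 x.2.2 := by
  have hfold : Primrec fun x : StructureCode × List Bool × ℕ =>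
      x.2.1.foldr (quantStep x.1.1) (solutions x.1.1 x.2.1.length x.1.2.1 x.1.2.2 x.2.2) :=
    list_foldr (h := fun (x : StructureCode × List Bool × ℕ) (y : Bool × List (List ℕ)) =>
        quantStep x.1.1 y.1 y.2) (fst.comp snd)
      (primrec_solutions.comp
        (fst.pair ((list_length.comp (fst.comp snd)).pair (snd.comp snd))))
      (primrec_quantStep.comp ((fst.comp (fst.comp fst)).pair snd))
  exact (primrecPred_exists_mem hfold
    (Primrec.eq.comp snd (const [])).primrecRel).of_eq fun x => by simp [PrenexTrue]

theorem primrec_quantCode : Primrec₂ quantCode := by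
  have hpair : ∀ {f : Bool × ℕ → ℕ}, Primrec f → Primrec fun x => 4 * Nat.pair (f x) 0 + 3 :=
    fun hf => nat_add.comp (nat_mul.comp (const 4) (Primrec₂.natPair.comp hf (const 0))) (const 3)
  have hall : ∀ {f : Bool × ℕ → ℕ}, Primrec f → Primrec fun x => 4 * f x + 4 :=
    fun hf => nat_add.comp (nat_mul.comp (const 4) hf) (const 4)
  exact Primrec.cond fst (hpair (hall (hpair snd))) (hall snd)

theorem primrec_prefixCode : Primrec₂ prefixCode :=
  list_foldr (h := fun _ y => quantCode y.1 y.2) fst snd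
    (primrec_quantCode.comp (fst.comp snd) (snd.comp snd))

theorem primrec_sizes : Primrec₂ sizes := by
  have hpow : Primrec₂ ((· ^ ·) : ℕ → ℕ → ℕ) := Primrec₂.unpaired'.1 Nat.Primrec.pow
  refine (nat_rec (f := fun t : ℕ => (t, 0))
    (g := fun _ x => (2 ^ x.2.1, x.2.1 * (x.2.2 + 1)))
    (Primrec.id.pair (const 0)) ?_).of_eq fun t r => ?_
  · have h1 : Primrec fun x : ℕ × ℕ × ℕ × ℕ => x.2.2.1 := fst.comp (snd.comp snd)
    have h2 : Primrec fun x : ℕ × ℕ × ℕ × ℕ => x.2.2.2 := snd.comp (snd.comp snd)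
    exact (hpow.comp (const 2) h1).pair (nat_mul.comp h1 (succ.comp h2))
  · induction r with
    | zero => rfl
    | succ r ih => simp only [ih, sizes]

theorem primrec_modelBound : Primrec modelBound := by
  have hpow : Primrec₂ ((· ^ ·) : ℕ → ℕ → ℕ) := Primrec₂.unpaired'.1 Nat.Primrec.pow
  exact nat_add.comp (snd.comp (primrec_sizes.comp (hpow.comp (const 2) succ) Primrec.id)) succ

theorem primrecPred_exists_structure :
    PrimrecPred fun x : ℕ × List Bool × ℕ =>
      ∃ D < modelBound x.1 + 1, 0 < D ∧ ∃ cs ∈ tuples (List.range D) (x.1 + 1),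
        ∃ T ∈ selections (groundAtoms D x.1), PrenexTrue D cs T x.2.1 x.2.2 := by
  refine primrecPred_exists_lt (succ.comp (primrec_modelBound.comp fst)) ?_
  refine PrimrecPred.and (nat_lt.comp (const 0) snd) ?_
  refine primrecPred_exists_mem
    (primrec_tuples.comp (list_range.comp snd) (succ.comp (fst.comp fst))) ?_
  refine primrecPred_exists_mem (primrec_selections.comp
    (primrec_groundAtoms.comp (snd.comp fst) (fst.comp (fst.comp fst)))) ?_
  exact primrecPred_prenexTrue.comp
    (((snd.comp (fst.comp fst)).pair ((snd.comp fst).pair snd)).pair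
      (snd.comp (fst.comp (fst.comp fst))))

theorem primrecPred_search :
    PrimrecPred fun c : ℕ =>
      ∃ n < c + 1, ∃ l ∈ tuples [false, true] n, ∃ p < c + 1, ∃ k < c + 1,
        (prefixCode l p = c ∧ matrixOK l k p = true ∧ ∀ b ∈ l.take k, b = true) ∧
        ∃ D < modelBound c + 1, 0 < D ∧ ∃ cs ∈ tuples (List.range D) (c + 1),
          ∃ T ∈ selections (groundAtoms D c), PrenexTrue D cs T l p := by
  refine primrecPred_exists_lt succ ?_
  refine primrecPred_exists_mem (primrec_tuples.comp (const _) snd) ?_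
  refine primrecPred_exists_lt (succ.comp (fst.comp fst)) ?_
  refine primrecPred_exists_lt (succ.comp (fst.comp (fst.comp fst))) ?_
  have hc : Primrec fun x : (((ℕ × ℕ) × List Bool) × ℕ) × ℕ => x.1.1.1.1 :=
    fst.comp (fst.comp (fst.comp fst))
  have hl : Primrec fun x : (((ℕ × ℕ) × List Bool) × ℕ) × ℕ => x.1.1.2 := snd.comp (fst.comp fst)
  have hp : Primrec fun x : (((ℕ × ℕ) × List Bool) × ℕ) × ℕ => x.1.2 := snd.comp fst
  refine PrimrecPred.and (PrimrecPred.and ?_ (PrimrecPred.and ?_ ?_)) ?_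
  · exact Primrec.eq.comp (primrec_prefixCode.comp hl hp) hc
  · exact Primrec.eq.comp (primrec_matrixOK.comp (hl.pair snd) hp) (const true)
  · exact primrecPred_forall_mem (list_take.comp snd hl)
      (Primrec.eq.comp snd (const true)).primrecRel
  · exact primrecPred_exists_structure.comp (hc.pair (hl.pair hp))

end Prim

end SeparatedFragment

/-- Satisfiability of sentences in the Separated Fragment is decidable: the set of Gödel numbers of
satisfiable sentences of the Separated Fragment is recursive. -/
theorem mainTheorem1 :
    ComputablePred fun c : ℕ =>
      ∃ φ : SeparatedFragment.signature.Sentence,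
        SeparatedFragment.code φ = c ∧ SeparatedFragment.IsSF φ ∧
          FirstOrder.Language.Theory.IsSatisfiable
            ({φ} : SeparatedFragment.signature.Theory) :=
  (SeparatedFragment.primrecPred_search.of_eq fun c =>
    (SeparatedFragment.exists_satisfiable_iff c).symm).computablePred
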